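/- Let $L\subset\mathbb{C}$ be a lattice (a discrete subgroup generated by two $\mathbb{R}$-linearly independent complex numbers) and $N\ge 1$. An \emph{elliptic function of level $N$ with lattice $L$} is a meromorphic function $f$ on $\mathbb{C}$ with $f(0)=0$, $f'(0)=1$ such that, for some $\rho\in\mathbb{C}$, the function $f^N$ is elliptic with lattice $L$ and has divisor $N\cdot 0-N\cdot\rho$ on $\mathbb{C}/L$, where $N$ is the minimal positive integer with this property. For $(q_1,q_2,q_3,q_4)\in\mathbb{C}^4$, a \emph{series solution with parameters $(q_1,q_2,q_3,q_4)$} is a formal power series $f(z)=z+\sum_{k\ge1}f_kz^{k+1}\in\mathbb{C}[[z]]$ that satisfies $$f f'''-3f'f''=6q_1(f')^2+12q_2ff'+12q_3f^2$$ and for which the series $Q(z)=z/f(z)$ has the form $Q(z)=1+q_1z+q_2z^2+q_3z^3+q_4z^4+O(z^5)$. Let $U_N\subset\mathbb{C}^4$ be the set of all $(q_1,q_2,q_3,q_4)$ for which some series solution with these parameters is the Taylor expansion at $0$ of an elliptic function of level $N$ (with some lattice), and let $M_N$ be the Zariski closure of $U_N$ in $\mathbb{C}^4$. A \emph{series corresponding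 to the elliptic function of level $N$} is a series solution with parameters in $M_N$. \textbf{Theorem.} $M_5$ is an irreducible two-dimensional algebraic subset of $\mathbb{C}^4$, and it is exactly the set of common zeros of the two equations $$q_1^4+6q_1^2q_2+2q_2^2+4q_1q_3+q_4=0,\qquad (11q_1^2+3q_2)^3-4(18q_1^3+6q_1q_2-q_3)^2=0.$$ Consequently, the series corresponding to the elliptic function of level $5$ are exactly the series solutions whose parameters $(q_1,q_2,q_3,q_4)$ satisfy these two equations. -/

import Mathlib

noncomputable section

namespace Hirzebruch

/-! Points `q : Fin 4 → ℂ` are `(q₁, q₂, q₃, q₄)`, that is, `q 0 = q₁`, ..., `q 3 = q₄`. -/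

/-- For a meromorphic function `f`, a lattice `L` and `N`: the function `g = f ^ N` is elliptic with
lattice `L` and has the divisor `N · 0 - N · ρ` on `ℂ / L`, for some `ρ`. -/
def HasPowerWithDivisor (L : PeriodPair) (N : ℕ) (f : ℂ → ℂ) : Prop :=
  ∃ ρ : ℂ,
    (∀ ω ∈ L.lattice, ∀ z : ℂ, (f (z + ω)) ^ N = (f z) ^ N) ∧
    ∀ z : ℂ, meromorphicOrderAt (fun w => (f w) ^ N) z =
      (((Set.indicator {w : ℂ | w ∈ L.lattice} (fun _ => (N : ℤ)) z
        - Set.indicator {w : ℂ | w - ρ ∈ L.lattice} (fun _ => (N : ℤ)) z : ℤ)) : WithTop ℤ)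

/-- `f` is an elliptic function of level `N` with lattice `L`. A meromorphic function on `ℂ` is
represented by its normal form: removable singularities are removed and the value at a pole
is `0`. -/
structure IsEllipticOfLevel (L : PeriodPair) (N : ℕ) (f : ℂ → ℂ) : Prop where
  meromorphic : MeromorphicNFOn f Set.univ
  map_zero : f 0 = 0
  deriv_zero : HasDerivAt f 1 0
  pos : 0 < N
  power : HasPowerWithDivisor L N f
  minimal : ∀ m : ℕ, 0 < m → HasPowerWithDivisor L m f → N ≤ m

/-- The formal power series `s` is the series expansion of `f` at zero. -/
def IsExpansionAtZero (s : PowerSeries ℂ) (f : ℂ → ℂ) : Prop :=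
  HasFPowerSeriesAt f (FormalMultilinearSeries.ofScalars ℂ fun k => PowerSeries.coeff k s) 0

/-- The series `f = z + ∑ fₖ z ^ (k + 1)` has parameters `(q₁, q₂, q₃, q₄)`, that is, the series
`Q` with `Q f = z` is `1 + q₁ z + q₂ z ^ 2 + q₃ z ^ 3 + q₄ z ^ 4 + ⋯`. -/
def HasParameters (q : Fin 4 → ℂ) (f : PowerSeries ℂ) : Prop :=
  PowerSeries.coeff 0 f = 0 ∧ PowerSeries.coeff 1 f = 1 ∧
    ∃ Q : PowerSeries ℂ, Q * f = PowerSeries.X ∧ PowerSeries.coeff 0 Q = 1 ∧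
      ∀ i : Fin 4, PowerSeries.coeff ((i : ℕ) + 1) Q = q i

/-- The differential equation `f f''' - 3 f' f'' = 6 q₁ (f')² + 12 q₂ f f' + 12 q₃ f²` for formal
power series. -/
def SatisfiesODE (q₁ q₂ q₃ : ℂ) (f : PowerSeries ℂ) : Prop :=
  let D := PowerSeries.derivative ℂ
  f * D (D (D f)) - 3 * D f * D (D f) =
    PowerSeries.C (6 * q₁) * (D f) ^ 2 + PowerSeries.C (12 * q₂) * (f * D f)
      + PowerSeries.C (12 * q₃) * f ^ 2

/-- `f` is a series solution of the differential equation, with parameters `(q₁, q₂, q₃, q₄)`. -/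
def IsSeriesSolution (q : Fin 4 → ℂ) (f : PowerSeries ℂ) : Prop :=
  HasParameters q f ∧ SatisfiesODE (q 0) (q 1) (q 2) f

/-- The set `U_N` of those `q` in `ℂ⁴` for which a series solution with parameters `q` is the
series expansion at zero of an elliptic function of level `N`, for some lattice. -/
def levelParameters (N : ℕ) : Set (Fin 4 → ℂ) :=
  {q | ∃ s : PowerSeries ℂ, IsSeriesSolution q s ∧
    ∃ (L : PeriodPair) (f : ℂ → ℂ), IsEllipticOfLevel L N f ∧ IsExpansionAtZero s f}

/-- A subset of affine space is Zariski closed if it is the zero locus of some ideal. -/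
def IsZariskiClosed (Z : Set (Fin 4 → ℂ)) : Prop :=
  ∃ I : Ideal (MvPolynomial (Fin 4) ℂ), Z = MvPolynomial.zeroLocus ℂ I

/-- The Zariski closure: the common zeros of all polynomials that vanish on `S`. -/
def zariskiClosure (S : Set (Fin 4 → ℂ)) : Set (Fin 4 → ℂ) :=
  MvPolynomial.zeroLocus ℂ (MvPolynomial.vanishingIdeal ℂ S)

/-- A set is irreducible in the Zariski topology if it is nonempty and is not contained in a union
of two Zariski closed sets neither of which contains it. -/
def IsZariskiIrreducible (V : Set (Fin 4 → ℂ)) : Prop :=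
  V.Nonempty ∧ ∀ Z₁ Z₂ : Set (Fin 4 → ℂ), IsZariskiClosed Z₁ → IsZariskiClosed Z₂ →
    V ⊆ Z₁ ∪ Z₂ → V ⊆ Z₁ ∨ V ⊆ Z₂

/-- The dimension of an algebraic set: the Krull dimension of its coordinate ring. -/
def algebraicDim (V : Set (Fin 4 → ℂ)) : WithBot ℕ∞ :=
  ringKrullDim (MvPolynomial (Fin 4) ℂ ⧸ MvPolynomial.vanishingIdeal ℂ V)

/-- The variety `M_N`, the Zariski closure of `U_N` in `ℂ⁴`. -/
def levelVariety (N : ℕ) : Set (Fin 4 → ℂ) :=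
  zariskiClosure (levelParameters N)

/-- A series corresponding to the elliptic function of level `N`: a series solution of the
differential equation with parameters in `M_N`. -/
def CorrespondsToLevel (N : ℕ) (f : PowerSeries ℂ) : Prop :=
  ∃ q ∈ levelVariety N, IsSeriesSolution q f

end Hirzebruch

end

/-!
The proof studies an elliptic function `f` of level `N` through its logarithmic derivative
`h = f' / f`, which is elliptic, with simple poles at `0` and `ρ` and residues `1` and `-1`.

*The differential equation.* By Liouville's theorem `h (ρ - z) = h z`. Written in terms of `h`, the
differential equation says that `D = h'' - 2 h ^ 3 - 6 q₁ h ^ 2 - 12 q₂ h - 12 q₃` vanishes. The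
parameters are such that `D` has a zero at `0`; by the symmetry it has no pole at `ρ`, so `D = 0`.
Hence the Taylor series of every elliptic function of level `N` is a series solution
(`IsEllipticOfLevel.isSeriesSolution`). Conversely the parameters determine the series solution
(`IsSeriesSolution.eq`), thus the function and its lattice (`mem_lattice_iff_of_hasParameters`).

*The two equations.* For `N = 5` the functions `f ^ (-5)` and `f ^ (-5) h ^ 2` are elliptic with
poles only in the lattice, so their residues at `0` vanish
(`IsElliptic.coeff_taylorSeries_eq_zero`). The first residue gives the first equation; the second
one, after elimination of the next two coefficients of `z / f` with the help of the differential
equation, gives the second (`levelFive_equations`).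

*The locus.* The second equation is that of a cuspidal cubic in suitable coordinates, so the common
zeros of the two equations are the image of a plane with coordinates `a`, `s`
(`mem_levelFiveLocus_iff`). A polynomial vanishes on the locus iff its pullback to the plane is
zero. This gives irreducibility, and the dimension follows from two integral extensions: the
coordinate ring of the locus is integral over a polynomial ring in two variables, and the
polynomial ring `ℂ[a, s]` is integral over the coordinate ring.

*Density.* Quotients of theta products give an elliptic function of level `5` for each lattice
`⟨1, τ⟩` with `τ` in the upper half plane (`isEllipticOfLevel_levelFiveFunction`). Homotheties
`z ↦ c z` act on the points `(a, s)` by scalars, so the points coming from elliptic functions form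
a union of punctured lines through the origin, possibly with the origin itself. If there were only
finitely many of these lines, then, the parameters determining the lattice, only countably many `τ`
would occur (`infinite_ratios`). So the pullback of a polynomial vanishing on `levelParameters 5`
vanishes on infinitely many lines, and is zero.
-/

open Filter Topology

/-! ### Taylor series at the origin -/

namespace Hirzebruch

/-- The Taylor series at `0` of a function on `ℂ`, as a formal power series. -/
noncomputable def taylorSeries (f : ℂ → ℂ) : PowerSeries ℂ :=
  PowerSeries.mk fun n => iteratedDeriv n f 0 / (n.factorial : ℂ)

variable {f g : ℂ → ℂ}

@[simp]
lemma coeff_taylorSeries (f : ℂ → ℂ) (n : ℕ) :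
    PowerSeries.coeff n (taylorSeries f) = iteratedDeriv n f 0 / (n.factorial : ℂ) := by
  simp [taylorSeries]

lemma taylorSeries_congr (h : f =ᶠ[𝓝 0] g) : taylorSeries f = taylorSeries g := by
  ext n
  simp [h.iteratedDeriv_eq n]

lemma taylorSeries_mul (hf : AnalyticAt ℂ f 0) (hg : AnalyticAt ℂ g 0) :
    taylorSeries (fun z => f z * g z) = taylorSeries f * taylorSeries g := by
  ext n
  rw [coeff_taylorSeries, iteratedDeriv_fun_mul hf.contDiffAt hg.contDiffAt,
    PowerSeries.coeff_mul, Finset.Nat.sum_antidiagonal_eq_sum_range_succ_mk, Finset.sum_div]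
  refine Finset.sum_congr rfl fun i hi => ?_
  have hi' : i ≤ n := Nat.lt_succ_iff.mp (Finset.mem_range.mp hi)
  have h1 : (n.factorial : ℂ) = n.choose i * i.factorial * (n - i).factorial := by
    exact_mod_cast (Nat.choose_mul_factorial_mul_factorial hi').symm
  have h2 : (n.choose i : ℂ) ≠ 0 := by exact_mod_cast (Nat.choose_pos hi').ne'
  have h3 : (i.factorial : ℂ) ≠ 0 := by exact_mod_cast i.factorial_ne_zero
  have h4 : ((n - i).factorial : ℂ) ≠ 0 := by exact_mod_cast (n - i).factorial_ne_zero
  simp only [coeff_taylorSeries]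
  rw [h1]
  field_simp

lemma taylorSeries_add (hf : AnalyticAt ℂ f 0) (hg : AnalyticAt ℂ g 0) :
    taylorSeries (fun z => f z + g z) = taylorSeries f + taylorSeries g := by
  ext n
  rw [coeff_taylorSeries, iteratedDeriv_fun_add hf.contDiffAt hg.contDiffAt]
  simp [add_div]

lemma taylorSeries_sub (hf : AnalyticAt ℂ f 0) (hg : AnalyticAt ℂ g 0) :
    taylorSeries (fun z => f z - g z) = taylorSeries f - taylorSeries g := by
  ext n
  rw [coeff_taylorSeries, iteratedDeriv_fun_sub hf.contDiffAt hg.contDiffAt]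
  simp [sub_div]

lemma taylorSeries_const (c : ℂ) : taylorSeries (fun _ => c) = PowerSeries.C c := by
  ext n
  rw [coeff_taylorSeries, iteratedDeriv_const, PowerSeries.coeff_C]
  split_ifs with h <;> simp [h]

lemma taylorSeries_pow (hf : AnalyticAt ℂ f 0) (n : ℕ) :
    taylorSeries (fun z => f z ^ n) = taylorSeries f ^ n := by
  induction n with
  | zero => simpa using taylorSeries_const 1
  | succ n ih =>
    simp only [pow_succ]
    rw [taylorSeries_mul (hf.fun_pow n) hf, ih]

lemma taylorSeries_id : taylorSeries (fun z => z) = PowerSeries.X := by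
  ext n
  rw [coeff_taylorSeries, PowerSeries.coeff_X]
  have h : iteratedDeriv n (fun z : ℂ => z) 0 = if n = 0 then 0 else if n = 1 then 1 else 0 :=
    iteratedDeriv_id
  rw [h]
  rcases n with _ | _ | n <;> simp

lemma taylorSeries_deriv (f : ℂ → ℂ) :
    taylorSeries (deriv f) = PowerSeries.derivative ℂ (taylorSeries f) := by
  ext n
  rw [PowerSeries.coeff_derivative, coeff_taylorSeries, coeff_taylorSeries,
    ← iteratedDeriv_succ', Nat.factorial_succ]
  have h3 : (n.factorial : ℂ) ≠ 0 := by exact_mod_cast n.factorial_ne_zero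
  have h4 : (n + 1 : ℂ) ≠ 0 := by exact_mod_cast n.succ_ne_zero
  push_cast
  field_simp

lemma isExpansionAtZero_taylorSeries (hf : AnalyticAt ℂ f 0) :
    IsExpansionAtZero (taylorSeries f) f := by
  have := hf.hasFPowerSeriesAt
  simpa [IsExpansionAtZero] using this

lemma IsExpansionAtZero.analyticAt {s : PowerSeries ℂ} (h : IsExpansionAtZero s f) :
    AnalyticAt ℂ f 0 := HasFPowerSeriesAt.analyticAt h

lemma IsExpansionAtZero.eq_taylorSeries {s : PowerSeries ℂ} (h : IsExpansionAtZero s f) :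
    s = taylorSeries f := by
  have h2 := isExpansionAtZero_taylorSeries h.analyticAt
  have := FormalMultilinearSeries.ofScalars_series_injective ℂ ℂ
    (HasFPowerSeriesAt.eq_formalMultilinearSeries h h2)
  ext n
  exact congrFun this n

lemma eventuallyEq_of_taylorSeries_eq (hf : AnalyticAt ℂ f 0) (hg : AnalyticAt ℂ g 0)
    (h : taylorSeries f = taylorSeries g) : f =ᶠ[𝓝 0] g := by
  have h1 : HasFPowerSeriesAt f _ 0 := isExpansionAtZero_taylorSeries hf
  have h2 : HasFPowerSeriesAt g _ 0 := isExpansionAtZero_taylorSeries hg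
  rw [h] at h1
  filter_upwards [HasFPowerSeriesAt.eventually_hasSum h1, HasFPowerSeriesAt.eventually_hasSum h2]
    with z h1 h2
  simpa using h1.unique h2

/-- If the first `n` Taylor coefficients vanish, the function is divisible by `z ^ n`. -/
lemma exists_eq_pow_mul_of_coeff_taylorSeries_eq_zero (hf : AnalyticAt ℂ f 0) (n : ℕ)
    (h : ∀ i < n, PowerSeries.coeff i (taylorSeries f) = 0) :
    ∃ g : ℂ → ℂ, AnalyticAt ℂ g 0 ∧ ∀ᶠ z in 𝓝 0, f z = z ^ n * g z := by
  have h1 : (n : ℕ∞) ≤ analyticOrderAt f 0 := by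
    rw [natCast_le_analyticOrderAt_iff_iteratedDeriv_eq_zero hf]
    intro i hi
    have := h i hi
    rw [coeff_taylorSeries, div_eq_zero_iff] at this
    exact this.resolve_right (by exact_mod_cast i.factorial_ne_zero)
  rw [natCast_le_analyticOrderAt hf] at h1
  simpa using h1

end Hirzebruch

/-! ### Elliptic functions: Liouville's theorem and the residue theorem -/

namespace Hirzebruch

/-- `g` is meromorphic on `ℂ` and invariant under translation by the lattice of `L`. The invariance
is required at every point, so it also concerns the values which `g` takes at its poles. -/
structure IsElliptic (L : PeriodPair) (g : ℂ → ℂ) : Prop where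
  meromorphic : Meromorphic g
  periodic : ∀ ω ∈ L.lattice, ∀ z, g (z + ω) = g z

namespace IsElliptic

variable {L : PeriodPair} {g k : ℂ → ℂ}

lemma const (c : ℂ) : IsElliptic L fun _ => c := ⟨Meromorphic.const c, fun _ _ _ => rfl⟩

lemma add (hg : IsElliptic L g) (hk : IsElliptic L k) : IsElliptic L fun z => g z + k z :=
  ⟨hg.meromorphic.add hk.meromorphic,
    fun ω hω z => by simp only [hg.periodic ω hω, hk.periodic ω hω]⟩

lemma sub (hg : IsElliptic L g) (hk : IsElliptic L k) : IsElliptic L fun z => g z - k z :=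
  ⟨hg.meromorphic.sub hk.meromorphic,
    fun ω hω z => by simp only [hg.periodic ω hω, hk.periodic ω hω]⟩

lemma mul (hg : IsElliptic L g) (hk : IsElliptic L k) : IsElliptic L fun z => g z * k z :=
  ⟨hg.meromorphic.mul hk.meromorphic,
    fun ω hω z => by simp only [hg.periodic ω hω, hk.periodic ω hω]⟩

lemma const_mul (c : ℂ) (hg : IsElliptic L g) : IsElliptic L fun z => c * g z := (const c).mul hg

lemma pow (hg : IsElliptic L g) (n : ℕ) : IsElliptic L fun z => g z ^ n :=
  ⟨hg.meromorphic.pow, fun ω hω z => by simp only [hg.periodic ω hω]⟩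

lemma inv (hg : IsElliptic L g) : IsElliptic L fun z => (g z)⁻¹ :=
  ⟨hg.meromorphic.inv, fun ω hω z => by simp only [hg.periodic ω hω]⟩

lemma deriv (hg : IsElliptic L g) : IsElliptic L (deriv g) := by
  refine ⟨hg.meromorphic.deriv, fun ω hω z => ?_⟩
  rw [← deriv_comp_add_const]
  exact congrFun (congrArg _root_.deriv (funext fun w => hg.periodic ω hω w)) z

lemma comp_const_sub (hg : IsElliptic L g) (ρ : ℂ) : IsElliptic L fun z => g (ρ - z) := by
  refine ⟨fun z => (hg.meromorphic (ρ - z)).comp_analyticAt (g := fun z => ρ - z) (by fun_prop),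
    fun ω hω z => ?_⟩
  rw [← hg.periodic ω hω (ρ - (z + ω))]
  congr 1
  ring

lemma meromorphicOrderAt_add (hg : IsElliptic L g) {ω : ℂ} (hω : ω ∈ L.lattice) (z : ℂ) :
    meromorphicOrderAt g (z + ω) = meromorphicOrderAt g z := by
  rw [← meromorphicOrderAt_fun_comp_add_const_eq_meromorphicOrderAt]
  congr 1
  exact funext fun w => hg.periodic ω hω w

lemma meromorphicOrderAt_of_mem (hg : IsElliptic L g) {ω : ℂ} (hω : ω ∈ L.lattice) :
    meromorphicOrderAt g ω = meromorphicOrderAt g 0 := by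
  simpa using hg.meromorphicOrderAt_add hω 0

/-- Liouville's theorem: an elliptic function without poles is constant, up to its values on a
discrete set. -/
theorem exists_eventuallyEq_const (hg : IsElliptic L g) (h : ∀ z, 0 ≤ meromorphicOrderAt g z) :
    ∃ c, ∀ z, g =ᶠ[𝓝[≠] z] fun _ => c := by
  have hm : MeromorphicOn g Set.univ := hg.meromorphic.meromorphicOn
  set G := toMeromorphicNFOn g Set.univ with hG
  have hNF : ∀ z, MeromorphicNFAt G z := fun z =>
    meromorphicNFOn_toMeromorphicNFOn g Set.univ (Set.mem_univ z)
  have hGg : ∀ z, G =ᶠ[𝓝[≠] z] g := fun z =>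
    hm.toMeromorphicNFOn_eq_self_on_nhdsNE (Set.mem_univ z)
  have hd : Differentiable ℂ G := fun z => by
    refine ((hNF z).meromorphicOrderAt_nonneg_iff_analyticAt.1 ?_).differentiableAt
    rw [meromorphicOrderAt_congr (hGg z)]
    exact h z
  have hp : ∀ z ω, ω ∈ L.lattice → G (z + ω) = G z := by
    intro z ω hω
    have hshift : Tendsto (fun w => w + ω) (𝓝[≠] z) (𝓝[≠] (z + ω)) := by
      refine tendsto_nhdsWithin_iff.2 ⟨?_, ?_⟩
      · exact ((continuous_id.add continuous_const).tendsto z).mono_left nhdsWithin_le_nhds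
      · filter_upwards [self_mem_nhdsWithin] with w hw
        simpa using hw
    have h1 : (fun w => G (w + ω)) =ᶠ[𝓝[≠] z] G := by
      filter_upwards [hshift.eventually (hGg (z + ω)), hGg z] with w h1 h2
      rw [h1, h2, hg.periodic ω hω]
    have h2 : (fun w => G (w + ω)) =ᶠ[𝓝 z] G :=
      ((((hd.comp (differentiable_id.add_const ω)).analyticAt z).meromorphicNFAt
        ).eventuallyEq_nhdsNE_iff_eventuallyEq_nhds (hNF z)).1 h1
    exact h2.eq_of_nhds
  have hb := (IsZLattice.isCompact_range_of_periodic L.lattice G hd.continuous hp).isBounded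
  refine ⟨G 0, fun z => (hGg z).symm.trans (Eventually.of_forall fun w => ?_)⟩
  exact hd.apply_eq_apply_of_bounded hb w 0

lemma exists_eventuallyEq_const_of_notMem (hg : IsElliptic L g)
    (h : ∀ z ∉ L.lattice, 0 ≤ meromorphicOrderAt g z) (h0 : 0 ≤ meromorphicOrderAt g 0) :
    ∃ c, ∀ z, g =ᶠ[𝓝[≠] z] fun _ => c := by
  refine hg.exists_eventuallyEq_const fun z => ?_
  by_cases hz : z ∈ L.lattice
  · rwa [hg.meromorphicOrderAt_of_mem hz]
  · exact h z hz

/-- The existence of an analytic continuation, as a criterion for being free of poles. -/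
lemma _root_.MeromorphicAt.order_nonneg_of_eventuallyEq {f A : ℂ → ℂ} {z : ℂ}
    (hA : AnalyticAt ℂ A z) (h : f =ᶠ[𝓝[≠] z] A) : 0 ≤ meromorphicOrderAt f z := by
  rw [meromorphicOrderAt_congr h]
  exact hA.meromorphicOrderAt_nonneg

/-- No elliptic function has a single simple pole modulo the lattice. Such a `g` would satisfy a
Riccati equation `r g' = -(g - α) (g - β)`, hence `I = 1 / (g - α)` would satisfy the linear
equation `r I' = 1 + (α - β) I`, which excludes poles of `I`; so `I` would be constant, but it has
a zero at the pole of `g`. -/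
theorem meromorphicOrderAt_zero_ne_neg_one (hg : IsElliptic L g)
    (h : ∀ z ∉ L.lattice, 0 ≤ meromorphicOrderAt g z) : meromorphicOrderAt g 0 ≠ -1 := by
  intro h0
  have hm := hg.meromorphic
  obtain ⟨G, hG, hG0, hgG⟩ := (meromorphicOrderAt_eq_int_iff (n := -1) (hm 0)).1
    (by simpa using h0)
  simp only [sub_zero, zpow_neg_one, smul_eq_mul] at hgG
  set r := G 0 with hr
  set c := 2 * _root_.deriv G 0 with hc
  -- the combination below has no pole at the origin
  have hK : IsElliptic L fun z => g z ^ 2 + r * _root_.deriv g z - c * g z :=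
    ((hg.pow 2).add (hg.deriv.const_mul r)).sub (hg.const_mul c)
  obtain ⟨K, hK⟩ : ∃ K, ∀ z, (fun z => g z ^ 2 + r * _root_.deriv g z - c * g z)
      =ᶠ[𝓝[≠] z] fun _ => K := by
    refine hK.exists_eventuallyEq_const_of_notMem (fun z hz => ?_) ?_
    · obtain ⟨A, hA, hgA⟩ := (hm z).meromorphicOrderAt_nonneg_iff.1 (h z hz)
      refine MeromorphicAt.order_nonneg_of_eventuallyEq
        (A := fun z => A z ^ 2 + r * _root_.deriv A z - c * A z) ?_ ?_
      · exact ((hA.fun_pow 2).fun_add (analyticAt_const.fun_mul hA.deriv)).fun_sub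
          (analyticAt_const.fun_mul hA)
      · filter_upwards [hgA, hgA.nhdsNE_deriv] with w h1 h2
        rw [h1, h2]
    · have hN : AnalyticAt ℂ
          (fun z => G z ^ 2 - r * G z + z * (r * _root_.deriv G z) - c * z * G z) 0 := by
        have := hG.deriv
        fun_prop
      obtain ⟨A, hA, hNA⟩ := exists_eq_pow_mul_of_coeff_taylorSeries_eq_zero hN 2 (by
        intro i hi
        rw [coeff_taylorSeries, div_eq_zero_iff]
        left
        interval_cases i
        · simp only [iteratedDeriv_zero, ← hr]
          ring
        · rw [iteratedDeriv_one]
          have hG' := hG.differentiableAt.hasDerivAt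
          have h1 := ((((hG'.fun_pow 2).fun_sub (hG'.const_mul r)).fun_add
            ((hasDerivAt_id (0 : ℂ)).fun_mul
              (hG.deriv.differentiableAt.hasDerivAt.const_mul r))).fun_sub
            (((hasDerivAt_id (0 : ℂ)).const_mul c).fun_mul hG')).deriv
          simp only [id_def] at h1
          rw [h1, hc, ← hr]
          push_cast
          ring)
      refine MeromorphicAt.order_nonneg_of_eventuallyEq hA ?_
      have hdG : ∀ᶠ z in 𝓝[≠] (0 : ℂ),
          _root_.deriv g z = -(z ^ 2)⁻¹ * G z + z⁻¹ * _root_.deriv G z := by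
        have h1 : g =ᶠ[𝓝[≠] 0] fun z => z⁻¹ * G z := hgG
        filter_upwards [h1.nhdsNE_deriv, nhdsWithin_le_nhds hG.eventually_analyticAt,
          self_mem_nhdsWithin] with z h2 h3 h4
        rw [h2]
        exact ((hasDerivAt_inv h4).fun_mul h3.differentiableAt.hasDerivAt).deriv
      filter_upwards [hgG, hdG, nhdsWithin_le_nhds hNA, self_mem_nhdsWithin] with z h1 h2 h3 h4
      have hz : z ≠ 0 := h4
      rw [h1, h2]
      have h5 : A z = (G z ^ 2 - r * G z + z * (r * _root_.deriv G z) - c * z * G z) / z ^ 2 := by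
        rw [h3]
        field_simp
      rw [h5]
      field_simp
      ring
  -- factor the Riccati equation
  obtain ⟨α, β, hαβ, hprod⟩ : ∃ α β : ℂ, α + β = c ∧ α * β = -K := by
    obtain ⟨d, hd⟩ := IsAlgClosed.exists_pow_nat_eq (c ^ 2 + 4 * K) (n := 2) (by norm_num)
    refine ⟨(c + d) / 2, (c - d) / 2, by ring, ?_⟩
    linear_combination (-1 / 4 : ℂ) * hd
  have hI : IsElliptic L fun z => (g z - α)⁻¹ := (hg.sub (const α)).inv
  have hord : meromorphicOrderAt (fun z => g z - α) 0 = -1 := by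
    have h2 : (fun z => g z - α) = g + fun _ => -α := by
      ext z
      simp [sub_eq_add_neg]
    rw [h2, meromorphicOrderAt_add_eq_left_of_lt (MeromorphicAt.const _ _), h0]
    rw [h0]
    exact lt_of_lt_of_le (by decide) (analyticAt_const.meromorphicOrderAt_nonneg)
  have hne : ∀ z, ∀ᶠ w in 𝓝[≠] z, g w - α ≠ 0 := by
    intro z
    rw [← meromorphicOrderAt_ne_top_iff_eventually_ne_zero ((hg.sub (const α)).meromorphic z)]
    refine MeromorphicOn.meromorphicOrderAt_ne_top_of_isPreconnected
      (hg.sub (const α)).meromorphic.meromorphicOn isPreconnected_univ (Set.mem_univ 0)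
      (Set.mem_univ z) ?_
    rw [hord]
    decide
  have hlin : ∀ z, _root_.deriv (fun z => (g z - α)⁻¹) =ᶠ[𝓝[≠] z]
      fun w => r⁻¹ + r⁻¹ * (α - β) * (g w - α)⁻¹ := by
    intro z
    filter_upwards [hne z, hK z, (hm z).eventually_analyticAt] with w h1 h2 h3
    rw [((h3.differentiableAt.hasDerivAt.sub_const α).fun_inv h1).deriv]
    have h5 : r * _root_.deriv g w = -(g w - α) * (g w - β) := by
      linear_combination h2 - g w * hαβ + hprod
    have h6 : _root_.deriv g w = r⁻¹ * (-(g w - α) * (g w - β)) := by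
      rw [← h5]
      field_simp
    rw [h6]
    field_simp
    ring
  -- differentiation lowers the order of a pole, but the equation bounds it from below
  have hnonneg : ∀ z, 0 ≤ meromorphicOrderAt (fun z => (g z - α)⁻¹) z := by
    intro z
    by_contra hneg
    push Not at hneg
    obtain ⟨n, hn⟩ := WithTop.ne_top_iff_exists.1 (ne_top_of_lt hneg)
    rw [← hn] at hneg
    have hn0 : n < 0 := by exact_mod_cast hneg
    have h1 := meromorphicOrderAt_deriv_eq_sub_one (n := n) (by exact_mod_cast hn0.ne) hn.symm
    rw [meromorphicOrderAt_congr (hlin z)] at h1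
    have h2 := _root_.meromorphicOrderAt_add (x := z) (MeromorphicAt.const (r⁻¹) z)
      ((hI.const_mul (r⁻¹ * (α - β))).meromorphic z)
    have h3 : meromorphicOrderAt (((fun _ => r⁻¹ : ℂ → ℂ)) +
        fun z => r⁻¹ * (α - β) * (g z - α)⁻¹) z = ((n - 1 : ℤ) : WithTop ℤ) := h1
    rw [h3] at h2
    have h4 : (n : WithTop ℤ) ≤ meromorphicOrderAt (fun _ => r⁻¹ : ℂ → ℂ) z :=
      le_trans (by exact_mod_cast hn0.le) (analyticAt_const.meromorphicOrderAt_nonneg)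
    have h5 : (n : WithTop ℤ) ≤ meromorphicOrderAt (fun z => r⁻¹ * (α - β) * (g z - α)⁻¹) z := by
      have := fun_meromorphicOrderAt_mul (MeromorphicAt.const (r⁻¹ * (α - β)) z)
        (hI.meromorphic z)
      rw [this, ← hn]
      exact le_add_of_nonneg_left (analyticAt_const.meromorphicOrderAt_nonneg)
    have h6 := le_trans (le_min h4 h5) h2
    have : n ≤ n - 1 := by exact_mod_cast h6
    omega
  obtain ⟨d, hd⟩ := hI.exists_eventuallyEq_const hnonneg
  have h1 : meromorphicOrderAt (fun z => (g z - α)⁻¹) 0 = 1 := by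
    rw [fun_meromorphicOrderAt_inv, hord]
    rfl
  rw [meromorphicOrderAt_congr (hd 0), meromorphicOrderAt_const] at h1
  split_ifs at h1
  · exact absurd h1 (by decide)
  · exact absurd h1 (by decide)

/-- Elliptic functions with poles only at lattice points and principal part `a / z ^ (n + 2)` at
`0`: the derivatives of the Weierstrass function. -/
lemma exists_principalPart (L : PeriodPair) (n : ℕ) :
    ∃ p : ℂ → ℂ, IsElliptic L p ∧ (∀ z ∉ L.lattice, 0 ≤ meromorphicOrderAt p z) ∧
      ∃ (a : ℂ) (A : ℂ → ℂ), a ≠ 0 ∧ AnalyticAt ℂ A 0 ∧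
        p =ᶠ[𝓝[≠] 0] fun z => a * (z ^ (n + 2))⁻¹ + A z := by
  induction n with
  | zero =>
    refine ⟨L.weierstrassP, ⟨L.meromorphic_weierstrassP, fun ω hω z => ?_⟩, fun z hz => ?_,
      1, L.weierstrassPExcept 0, one_ne_zero, L.analyticAt_weierstrassPExcept 0, ?_⟩
    · exact L.weierstrassP_add_coe z ⟨ω, hω⟩
    · exact (L.analyticOnNhd_weierstrassP z hz).meromorphicOrderAt_nonneg
    · refine Eventually.of_forall fun z => ?_
      have := L.weierstrassPExcept_add 0 z
      simp only [ZeroMemClass.coe_zero, sub_zero] at this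
      rw [← this]
      simp
      ring
  | succ n ih =>
    obtain ⟨p, hp, hp', a, A, ha, hA, hpA⟩ := ih
    refine ⟨_root_.deriv p, hp.deriv, fun z hz => ?_, a * -(n + 2), _root_.deriv A,
      ?_, hA.deriv, ?_⟩
    · obtain ⟨B, hB, hpB⟩ := (hp.meromorphic z).meromorphicOrderAt_nonneg_iff.1 (hp' z hz)
      exact MeromorphicAt.order_nonneg_of_eventuallyEq hB.deriv hpB.nhdsNE_deriv
    · refine mul_ne_zero ha (neg_ne_zero.2 ?_)
      exact_mod_cast (n + 1).succ_ne_zero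
    · filter_upwards [hpA.nhdsNE_deriv, nhdsWithin_le_nhds hA.eventually_analyticAt,
        self_mem_nhdsWithin] with z h1 h2 h3
      have hz : z ≠ 0 := h3
      rw [h1, ((((hasDerivAt_pow (n + 2) z).fun_inv (pow_ne_zero _ hz)).const_mul a).fun_add
        h2.differentiableAt.hasDerivAt).deriv]
      congr 1
      push_cast
      field_simp
      ring

/-- The residue theorem for elliptic functions with poles only at lattice points: if
`g = G / z ^ (n + 1)` near `0`, then the residue at `0`, which is the `n`-th Taylor coefficient of
`G`, vanishes. -/
theorem coeff_taylorSeries_eq_zero (n : ℕ) {g G : ℂ → ℂ} (hg : IsElliptic L g)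
    (h : ∀ z ∉ L.lattice, 0 ≤ meromorphicOrderAt g z) (hG : AnalyticAt ℂ G 0)
    (hgG : g =ᶠ[𝓝[≠] 0] fun z => (z ^ (n + 1))⁻¹ * G z) :
    PowerSeries.coeff n (taylorSeries G) = 0 := by
  induction n generalizing g G with
  | zero =>
    by_contra h0
    refine hg.meromorphicOrderAt_zero_ne_neg_one h ?_
    refine (meromorphicOrderAt_eq_int_iff (n := -1) (hg.meromorphic 0)).2 ⟨G, hG, ?_, ?_⟩
    · simpa using h0
    · filter_upwards [hgG] with z hz
      simpa using hz
  | succ n ih =>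
    -- subtracting a multiple of `p` from `g` lowers the order of the pole, and `p` has no residue
    obtain ⟨p, hp, hp', a, A, ha, hA, hpA⟩ := exists_principalPart L n
    set b := G 0 / a with hb
    have hN : AnalyticAt ℂ (fun z => G z - G 0 - b * (z ^ (n + 2) * A z)) 0 := by fun_prop
    have hN0 : PowerSeries.coeff 0
        (taylorSeries fun z => G z - G 0 - b * (z ^ (n + 2) * A z)) = 0 := by
      simp
    obtain ⟨H, hH, hNH⟩ := exists_eq_pow_mul_of_coeff_taylorSeries_eq_zero hN 1 (by
      intro i hi
      rw [Nat.lt_one_iff.1 hi, hN0])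
    have key := ih (hg.sub (hp.const_mul b)) (fun z hz => ?_) hH ?_
    · have h1 := taylorSeries_congr hNH
      rw [taylorSeries_sub (by fun_prop) (by fun_prop),
        taylorSeries_sub (by fun_prop) (by fun_prop),
        taylorSeries_mul (by fun_prop) (by fun_prop), taylorSeries_mul (by fun_prop) (by fun_prop),
        taylorSeries_mul (by fun_prop) (by fun_prop), taylorSeries_const, taylorSeries_const,
        taylorSeries_pow (f := fun z => z) (by fun_prop),
        taylorSeries_pow (f := fun z => z) (by fun_prop),
        taylorSeries_id, pow_one] at h1
      have h2 := congrArg (PowerSeries.coeff (n + 1)) h1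
      rw [PowerSeries.coeff_succ_X_mul, key] at h2
      simpa [PowerSeries.coeff_X_pow_mul', PowerSeries.coeff_C] using h2
    · obtain ⟨B, hB, hpB⟩ := (hp.meromorphic z).meromorphicOrderAt_nonneg_iff.1 (hp' z hz)
      obtain ⟨C, hC, hgC⟩ := (hg.meromorphic z).meromorphicOrderAt_nonneg_iff.1 (h z hz)
      refine MeromorphicAt.order_nonneg_of_eventuallyEq (A := fun z => C z - b * B z)
        (by fun_prop) ?_
      filter_upwards [hpB, hgC] with w h1 h2
      rw [h1, h2]
    · filter_upwards [hgG, hpA, nhdsWithin_le_nhds hNH, self_mem_nhdsWithin] with z h1 h2 h3 h4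
      have hz : z ≠ 0 := h4
      rw [h1, h2]
      have h5 : H z = (G z - G 0 - b * (z ^ (n + 2) * A z)) / z := by
        rw [h3]
        field_simp
      rw [h5]
      have h6 : G 0 = b * a := by
        rw [hb]
        field_simp
      rw [h6]
      field_simp
      ring

end IsElliptic
end Hirzebruch

/-! ### Coefficients of series solutions -/

namespace Hirzebruch

open PowerSeries

lemma coeff_mul_eq_sum_range (n : ℕ) (A B : PowerSeries ℂ) :
    coeff n (A * B) = ∑ i ∈ Finset.range (n + 1), coeff i A * coeff (n - i) B := by
  rw [coeff_mul, Finset.Nat.sum_antidiagonal_eq_sum_range_succ_mk]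

/-- The left hand side minus the right hand side of the differential equation
`f f''' - 3 f' f'' = 6 q₁ (f')² + 12 q₂ f f' + 12 q₃ f²`. -/
noncomputable def odeDefect (q₁ q₂ q₃ : ℂ) (f : PowerSeries ℂ) : PowerSeries ℂ :=
  let D := PowerSeries.derivative ℂ
  f * D (D (D f)) - 3 * D f * D (D f) - (C (6 * q₁) * (D f) ^ 2 + C (12 * q₂) * (f * D f)
      + C (12 * q₃) * f ^ 2)

lemma satisfiesODE_iff {q₁ q₂ q₃ : ℂ} {f : PowerSeries ℂ} :
    SatisfiesODE q₁ q₂ q₃ f ↔ odeDefect q₁ q₂ q₃ f = 0 := sub_eq_zero.symm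

/-- The coefficients of `f` in terms of those of `Q = z / f`. -/
lemma coeff_of_mul_eq_X {Q f : PowerSeries ℂ} (hQ : Q * f = X) (hQ0 : coeff 0 Q = 1)
    (h0 : coeff 0 f = 0) (n : ℕ) :
    coeff (n + 2) f = - ∑ i ∈ Finset.range (n + 1), coeff (n + 1 - i) Q * coeff (i + 1) f := by
  have h := congrArg (coeff (n + 2)) hQ
  rw [mul_comm, coeff_mul_eq_sum_range, Finset.sum_range_succ, Finset.sum_range_succ', h0,
    coeff_X] at h
  rw [if_neg (by omega)] at h
  simp only [Nat.sub_self, hQ0, mul_one, zero_mul, add_zero] at h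
  rw [eq_neg_iff_add_eq_zero, add_comm, ← h]
  congr 1
  refine Finset.sum_congr rfl fun i _ => ?_
  rw [mul_comm, show n + 2 - (i + 1) = n + 1 - i by omega]

/-- The parameters are such that the differential equation holds to order three. -/
lemma coeff_odeDefect_eq_zero {q : Fin 4 → ℂ} {f : PowerSeries ℂ} (h : HasParameters q f) :
    ∀ i < 3, coeff i (odeDefect (q 0) (q 1) (q 2) f) = 0 := by
  obtain ⟨h0, h1, Q, hQ, hQ0, hq⟩ := h
  have e1 : coeff 1 Q = q 0 := hq 0
  have e2 : coeff 2 Q = q 1 := hq 1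
  have e3 : coeff 3 Q = q 2 := hq 2
  have f2 := coeff_of_mul_eq_X hQ hQ0 h0 0
  have f3 := coeff_of_mul_eq_X hQ hQ0 h0 1
  have f4 := coeff_of_mul_eq_X hQ hQ0 h0 2
  simp only [Finset.sum_range_succ, Finset.sum_range_zero, e1, e2, e3, h1, Nat.reduceAdd,
    Nat.reduceSub, zero_add, Nat.sub_zero] at f2 f3 f4
  intro i hi
  have h3 : (3 : PowerSeries ℂ) = C 3 := (map_ofNat C 3).symm
  interval_cases i <;>
  · simp only [odeDefect, map_sub, map_add, pow_two, coeff_mul_eq_sum_range, coeff_derivative, h3,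
      coeff_C, Finset.sum_range_succ, Finset.sum_range_zero, h0, h1, Nat.reduceAdd, Nat.reduceSub,
      f2, f3, f4]
    norm_num
    ring

/-- Series with the same parameters agree up to the coefficient of `z ^ 5`. -/
lemma coeff_eq_of_hasParameters {q : Fin 4 → ℂ} {f g : PowerSeries ℂ} (hf : HasParameters q f)
    (hg : HasParameters q g) : ∀ i < 6, coeff i f = coeff i g := by
  obtain ⟨f0, f1, Q, hQ, hQ0, hq⟩ := hf
  obtain ⟨g0, g1, R, hR, hR0, hr⟩ := hg
  have key : ∀ i, 1 ≤ i → i < 5 → coeff i Q = coeff i R := by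
    intro i hi hi'
    obtain ⟨j, rfl⟩ := Nat.exists_eq_add_of_le' hi
    exact (hq ⟨j, by omega⟩).trans (hr ⟨j, by omega⟩).symm
  intro i
  induction i using Nat.strong_induction_on with
  | _ i ih =>
    intro hi
    rcases i with _ | _ | n
    · rw [f0, g0]
    · rw [f1, g1]
    · rw [coeff_of_mul_eq_X hQ hQ0 f0, coeff_of_mul_eq_X hR hR0 g0]
      congr 1
      refine Finset.sum_congr rfl fun j hj => ?_
      have := Finset.mem_range.1 hj
      rw [key _ (by omega) (by omega), ih (j + 1) (by omega) (by omega)]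

/-- A series solution is determined by its parameters: the coefficient `f_n` of `z ^ n` enters the
differential equation with the factor `n (n - 1) (n - 5)`, so the equation determines it for
`n ≥ 6`, and the parameters determine the coefficients with `n ≤ 5`. -/
theorem IsSeriesSolution.eq {q : Fin 4 → ℂ} {f g : PowerSeries ℂ} (hf : IsSeriesSolution q f)
    (hg : IsSeriesSolution q g) : f = g := by
  have hlow := coeff_eq_of_hasParameters hf.1 hg.1
  have hdiv : ∀ m, (X : PowerSeries ℂ) ^ (m + 6) ∣ f - g := by
    intro m
    induction m with
    | zero =>
      rw [X_pow_dvd_iff]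
      intro i hi
      rw [map_sub, hlow i hi, sub_self]
    | succ m ih =>
      obtain ⟨e, he⟩ := ih
      obtain ⟨u, hu⟩ : (X : PowerSeries ℂ) ∣ g := X_dvd_iff.2 (by simpa using hg.1.1)
      have hu0 : constantCoeff u = 1 := by
        have := hg.1.2.1
        rw [hu, show (1 : ℕ) = 0 + 1 from rfl, coeff_succ_X_mul] at this
        simpa using this
      have hfe : f = X * u + X ^ (m + 6) * e := by
        rw [← he, ← hu]
        ring
      have h1 := satisfiesODE_iff.1 hf.2
      have h2 := satisfiesODE_iff.1 hg.2
      obtain ⟨D, hD⟩ : ∃ D, D = PowerSeries.derivative ℂ := ⟨_, rfl⟩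
      have hX : D X = 1 := by rw [hD]; exact derivative_X
      have hDX : ∀ (k : ℕ) (e : PowerSeries ℂ),
          D (X ^ (k + 1) * e) = X ^ k * (((k + 1 : ℕ) : PowerSeries ℂ) * e + X * D e) := by
        intro k e
        rw [D.leibniz, D.leibniz_pow, hX]
        simp only [smul_eq_mul, nsmul_eq_mul, Nat.add_sub_cancel]
        ring
      rw [hu] at h2
      rw [hfe] at h1
      obtain ⟨v, hv⟩ : ∃ v, v = D (X * u) := ⟨_, rfl⟩
      have hv0 : constantCoeff v = 1 := by
        rw [hv, D.leibniz, hX]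
        simp [hu0]
      obtain ⟨e1, he1⟩ : ∃ e1, e1 = ((m + 5 + 1 : ℕ) : PowerSeries ℂ) * e + X * D e :=
        ⟨_, rfl⟩
      obtain ⟨e2, he2⟩ : ∃ e2, e2 = ((m + 4 + 1 : ℕ) : PowerSeries ℂ) * e1 + X * D e1 :=
        ⟨_, rfl⟩
      obtain ⟨e3, he3⟩ : ∃ e3, e3 = ((m + 3 + 1 : ℕ) : PowerSeries ℂ) * e2 + X * D e2 :=
        ⟨_, rfl⟩
      have d1 : D (X ^ (m + 6) * e) = X ^ (m + 5) * e1 := (hDX (m + 5) e).trans (by rw [he1])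
      have d2 : D (X ^ (m + 5) * e1) = X ^ (m + 4) * e2 := (hDX (m + 4) e1).trans (by rw [he2])
      have d3 : D (X ^ (m + 4) * e2) = X ^ (m + 3) * e3 := (hDX (m + 3) e2).trans (by rw [he3])
      simp only [odeDefect, ← hD, map_add, ← hv, d1, d2, d3] at h1 h2
      -- the difference of the equations for `f` and `g`, divided by `X ^ (m + 4)`
      obtain ⟨S, hS⟩ : ∃ S, S = e * (X * X * D (D v) + X ^ (m + 5) * e3) + u * e3
          - 3 * (X * e1 * D v + v * e2 + X ^ (m + 5) * e1 * e2)
          - (C (6 * q 0) * X * e1 * (2 * v + X ^ (m + 5) * e1)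
            + C (12 * q 1) * (X * X * e * v + X * X * u * e1 + X ^ (m + 7) * e * e1)
            + C (12 * q 2) * (X * X * e) * (2 * X * u + X ^ (m + 6) * e)) := ⟨_, rfl⟩
      have h3 : X ^ (m + 4) * S = 0 := by
        rw [hS]
        linear_combination h1 - h2
      have h4 : S = 0 := (mul_eq_zero.1 h3).resolve_left (pow_ne_zero _ X_ne_zero)
      have h5 := congrArg constantCoeff h4
      rw [hS] at h5
      have c1 : constantCoeff e1 = (m + 6) * constantCoeff e := by
        simp only [he1, map_add, map_mul, map_natCast, constantCoeff_X, zero_mul, add_zero]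
        push_cast
        ring
      have c2 : constantCoeff e2 = (m + 5) * ((m + 6) * constantCoeff e) := by
        rw [← c1]
        simp only [he2, map_add, map_mul, map_natCast, constantCoeff_X, zero_mul, add_zero]
        push_cast
        ring
      have c3 : constantCoeff e3 = (m + 4) * ((m + 5) * ((m + 6) * constantCoeff e)) := by
        rw [← c2]
        simp only [he3, map_add, map_mul, map_natCast, constantCoeff_X, zero_mul, add_zero]
        push_cast
        ring
      simp only [map_add, map_sub, map_mul, map_pow, constantCoeff_X, hv0, hu0, c1, c2, c3,
        map_ofNat, map_zero] at h5
      have h6 : ((m + 1 : ℂ) * ((m + 5) * (m + 6))) * constantCoeff e = 0 := by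
        rw [← h5]
        ring
      have hm : ((m + 1 : ℂ) * ((m + 5) * (m + 6))) ≠ 0 := by
        exact_mod_cast (by positivity : (m + 1) * ((m + 5) * (m + 6)) ≠ 0)
      have h7 := (mul_eq_zero.1 h6).resolve_left hm
      obtain ⟨e', he'⟩ : (X : PowerSeries ℂ) ∣ e := X_dvd_iff.2 h7
      exact ⟨e', by rw [he, he']; ring⟩
  ext n
  have := X_pow_dvd_iff.1 (hdiv n) n (by omega)
  rwa [map_sub, sub_eq_zero] at this

/-- The equations of the level `5` variety follow from the differential equation and two vanishing
coefficients. With `Q = z / f` these are the residues at `0` of `f ^ (-5)` and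
`f ^ (-5) (f' / f) ^ 2`, since `f' / f = (Q - z Q') / (z Q)`. -/
theorem levelFive_equations {q : Fin 4 → ℂ} {f Q : PowerSeries ℂ} (h : IsSeriesSolution q f)
    (hQ : Q * f = X) (h4 : coeff 4 (Q ^ 5) = 0)
    (h6 : coeff 6 (Q ^ 3 * (Q - X * PowerSeries.derivative ℂ Q) ^ 2) = 0) :
    (q 0) ^ 4 + 6 * (q 0) ^ 2 * q 1 + 2 * (q 1) ^ 2 + 4 * q 0 * q 2 + q 3 = 0 ∧
      (11 * (q 0) ^ 2 + 3 * q 1) ^ 3 - 4 * (18 * (q 0) ^ 3 + 6 * q 0 * q 1 - q 2) ^ 2 = 0 := by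
  obtain ⟨⟨h0, h1, Q', hQ', hQ0, hq⟩, hode⟩ := h
  have hf : f ≠ 0 := by
    rintro rfl
    simp at h1
  obtain rfl : Q = Q' := mul_right_cancel₀ hf (hQ.trans hQ'.symm)
  have e1 : coeff 1 Q = q 0 := hq 0
  have e2 : coeff 2 Q = q 1 := hq 1
  have e3 : coeff 3 Q = q 2 := hq 2
  have e4 : coeff 4 Q = q 3 := hq 3
  have h3 : (3 : PowerSeries ℂ) = C 3 := (map_ofNat C 3).symm
  have f2 := coeff_of_mul_eq_X hQ hQ0 h0 0
  have f3 := coeff_of_mul_eq_X hQ hQ0 h0 1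
  have f4 := coeff_of_mul_eq_X hQ hQ0 h0 2
  have f5 := coeff_of_mul_eq_X hQ hQ0 h0 3
  have f6 := coeff_of_mul_eq_X hQ hQ0 h0 4
  have f7 := coeff_of_mul_eq_X hQ hQ0 h0 5
  simp only [Finset.sum_range_succ, Finset.sum_range_zero, e1, e2, e3, e4, h1, Nat.reduceAdd,
    Nat.reduceSub, zero_add, Nat.sub_zero] at f2 f3 f4 f5 f6 f7
  have hode' := satisfiesODE_iff.1 hode
  have E4 := congrArg (coeff 4) hode'
  have E5 := congrArg (coeff 5) hode'
  simp only [odeDefect, map_sub, map_add, pow_two, coeff_mul_eq_sum_range, coeff_derivative, h3,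
    coeff_C, Finset.sum_range_succ, Finset.sum_range_zero, h0, h1, Nat.reduceAdd, Nat.reduceSub,
    map_zero, zero_add, Nat.sub_zero, OfNat.ofNat_ne_zero, one_ne_zero, if_true, if_false,
    zero_mul, mul_zero, add_zero, Nat.cast_zero, Nat.cast_one, Nat.cast_ofNat] at E4 E5
  -- the first seven coefficients of the powers of `Q` and of `Q - z Q'`
  set G := Q - X * PowerSeries.derivative ℂ Q with hG
  have g0 : coeff 0 G = 1 := by
    rw [hG, map_sub, coeff_zero_X_mul, sub_zero, hQ0]
  have gs : ∀ n, coeff (n + 1) G = - n * coeff (n + 1) Q := by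
    intro n
    rw [hG, map_sub, coeff_succ_X_mul, coeff_derivative]
    ring
  have g1 := gs 0
  have g2 := gs 1
  have g3 := gs 2
  have g4 := gs 3
  have g5 := gs 4
  have g6 := gs 5
  simp only [Nat.reduceAdd, e1, e2, e3, e4, zero_add] at g1 g2 g3 g4 g5 g6
  push_cast at g1 g2 g3 g4 g5 g6
  simp only [pow_succ, pow_zero, one_mul, coeff_mul_eq_sum_range, Finset.sum_range_succ,
    Finset.sum_range_zero, Nat.reduceAdd, Nat.reduceSub, zero_add, Nat.sub_zero, hQ0, e1, e2, e3,
    e4, g0, g1, g2, g3, g4, g5, g6] at h4 h6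
  generalize coeff 5 Q = q5 at *
  generalize coeff 6 Q = q6 at *
  generalize q 0 = a at *
  generalize q 1 = b at *
  generalize q 2 = c at *
  generalize q 3 = d at *
  refine ⟨by linear_combination (1 / 5 : ℂ) * h4, ?_⟩
  -- `E4` and `E5` determine `q5` and `q6`, which are eliminated from `h6`
  rw [f7, f6, f5, f4, f3, f2] at E5
  rw [f6, f5, f4, f3, f2] at E4
  linear_combination h6 - (1 / 12 : ℂ) * E5 - a * E4 + (7 * a ^ 2 + 3 * b) * h4

end Hirzebruch

/-! ### The logarithmic derivative of an elliptic function of level `N` -/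

namespace Hirzebruch

/-- The divisor `0 - ρ` on `ℂ / L`, as a function on `ℂ`. -/
noncomputable def levelDivisor (L : PeriodPair) (ρ z : ℂ) : ℤ :=
  Set.indicator {w : ℂ | w ∈ L.lattice} (fun _ => (1 : ℤ)) z
    - Set.indicator {w : ℂ | w - ρ ∈ L.lattice} (fun _ => (1 : ℤ)) z

lemma levelDivisor_sub (L : PeriodPair) (ρ z : ℂ) :
    levelDivisor L ρ (ρ - z) = - levelDivisor L ρ z := by
  have h1 : ρ - z ∈ L.lattice ↔ z - ρ ∈ L.lattice := by
    rw [← neg_mem_iff, neg_sub]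
  have h2 : ρ - z - ρ ∈ L.lattice ↔ z ∈ L.lattice := by
    rw [← neg_mem_iff]
    simp
  classical
  simp only [levelDivisor, Set.indicator_apply, Set.mem_ofPred_eq, h1, h2]
  ring

/-- Near any point, a logarithmic derivative is the sum of a simple pole whose residue is the order
and an analytic function. -/
lemma exists_logDeriv_eventuallyEq {f : ℂ → ℂ} {x : ℂ} {n : ℤ} (hf : MeromorphicAt f x)
    (hn : meromorphicOrderAt f x = n) :
    ∃ A : ℂ → ℂ, AnalyticAt ℂ A x ∧ logDeriv f =ᶠ[𝓝[≠] x] fun z => n * (z - x)⁻¹ + A z := by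
  obtain ⟨g, hg, hg0, hfg⟩ := (meromorphicOrderAt_eq_int_iff hf).1 hn
  refine ⟨logDeriv g, hg.deriv.div hg hg0, ?_⟩
  have h1 : f =ᶠ[𝓝[≠] x] fun z => (z - x) ^ n * g z := hfg
  filter_upwards [logDeriv_congr_nhdsNE h1, nhdsWithin_le_nhds hg.eventually_analyticAt,
    nhdsWithin_le_nhds (hg.continuousAt.eventually_ne hg0), self_mem_nhdsWithin] with z h2 h3 h4 h5
  have hz : z - x ≠ 0 := sub_ne_zero.2 h5
  have h6 : HasDerivAt (fun z => (z - x) ^ n) (n * (z - x) ^ (n - 1)) z :=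
    (hasDerivAt_zpow n (z - x) (Or.inl hz)).comp_sub_const z x
  rw [h2, logDeriv_mul (f := fun z => (z - x) ^ n) z (zpow_ne_zero _ hz) h4 h6.differentiableAt
    h3.differentiableAt, logDeriv_apply, h6.deriv]
  congr 1
  rw [zpow_sub_one₀ hz]
  field_simp

lemma tendsto_const_sub_nhdsNE (ρ z : ℂ) :
    Tendsto (fun w => ρ - w) (𝓝[≠] z) (𝓝[≠] (ρ - z)) := by
  refine tendsto_nhdsWithin_iff.2 ⟨?_, ?_⟩
  · exact ((continuous_const.sub continuous_id).tendsto z).mono_left nhdsWithin_le_nhds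
  · filter_upwards [self_mem_nhdsWithin] with w hw
    simpa using hw

variable {L : PeriodPair} {N : ℕ} {f : ℂ → ℂ}

lemma IsEllipticOfLevel.analyticAt_zero (hf : IsEllipticOfLevel L N f) : AnalyticAt ℂ f 0 := by
  have h := hf.meromorphic (Set.mem_univ 0)
  exact h.meromorphicAt.analyticAt hf.deriv_zero.continuousAt

lemma IsEllipticOfLevel.coeff_taylorSeries (hf : IsEllipticOfLevel L N f) :
    PowerSeries.coeff 0 (taylorSeries f) = 0 ∧ PowerSeries.coeff 1 (taylorSeries f) = 1 := by
  rw [Hirzebruch.coeff_taylorSeries, Hirzebruch.coeff_taylorSeries]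
  simp [hf.map_zero, iteratedDeriv_one, hf.deriv_zero.deriv]

/-- The logarithmic derivative of an elliptic function of level `N` is elliptic. -/
theorem IsEllipticOfLevel.exists_logDeriv (hf : IsEllipticOfLevel L N f) :
    ∃ (ρ : ℂ) (h : ℂ → ℂ), IsElliptic L h ∧ (∀ z, h =ᶠ[𝓝[≠] z] logDeriv f) ∧
      ∀ z, meromorphicOrderAt f z = (levelDivisor L ρ z : ℤ) := by
  obtain ⟨ρ, hper, hord⟩ := hf.power
  have hm : Meromorphic f := fun z => (hf.meromorphic (Set.mem_univ z)).meromorphicAt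
  have hN : (N : ℂ) ≠ 0 := by exact_mod_cast hf.pos.ne'
  have hF : IsElliptic L fun z => f z ^ N := ⟨hm.pow, fun ω hω z => hper ω hω z⟩
  refine ⟨ρ, fun z => (N : ℂ)⁻¹ * (deriv (fun w => f w ^ N) z * (f z ^ N)⁻¹),
    (hF.deriv.mul hF.inv).const_mul _, fun z => ?_, fun z => ?_⟩
  · filter_upwards [(hm z).eventually_analyticAt] with w hw
    have h1 := logDeriv_fun_pow hw.differentiableAt N
    rw [logDeriv_apply] at h1
    rw [← div_eq_mul_inv, h1]
    field_simp
  · have h1 := hord z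
    rw [fun_meromorphicOrderAt_pow (hm z)] at h1
    cases h2 : meromorphicOrderAt f z with
    | top =>
      rw [h2, WithTop.mul_top (by exact_mod_cast hf.pos.ne')] at h1
      exact absurd h1 WithTop.top_ne_coe
    | coe m =>
      rw [h2] at h1
      have h3 : (N : ℤ) * m = N * levelDivisor L ρ z := by
        have h4 : (N : ℤ) * m = Set.indicator {w : ℂ | w ∈ L.lattice} (fun _ => (N : ℤ)) z
            - Set.indicator {w : ℂ | w - ρ ∈ L.lattice} (fun _ => (N : ℤ)) z := by
          exact_mod_cast h1
        rw [h4, levelDivisor]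
        classical
        simp only [Set.indicator_apply]
        split_ifs <;> simp
      rw [mul_left_cancel₀ (by exact_mod_cast hf.pos.ne') h3]

/-- The involution `z ↦ ρ - z` exchanges the zeros and the poles of `f`; it preserves the
logarithmic derivative. -/
lemma logDeriv_symmetric {ρ : ℂ} {h : ℂ → ℂ} (hm : Meromorphic f) (hh : IsElliptic L h)
    (hhf : ∀ z, h =ᶠ[𝓝[≠] z] logDeriv f)
    (hord : ∀ z, meromorphicOrderAt f z = (levelDivisor L ρ z : ℤ)) (z : ℂ) :
    (fun w => h (ρ - w)) =ᶠ[𝓝[≠] z] h := by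
  have hk : IsElliptic L fun w => h (ρ - w) - h w := (hh.comp_const_sub ρ).sub hh
  obtain ⟨c, hc⟩ := hk.exists_eventuallyEq_const (fun z => by
    obtain ⟨A, hA, hfA⟩ := exists_logDeriv_eventuallyEq (hm z) (hord z)
    obtain ⟨B, hB, hfB⟩ := exists_logDeriv_eventuallyEq (hm (ρ - z)) (hord (ρ - z))
    refine MeromorphicAt.order_nonneg_of_eventuallyEq (A := fun w => B (ρ - w) - A w) ?_ ?_
    · exact (hB.comp_of_eq (f := fun w => ρ - w) (by fun_prop) rfl).fun_sub hA
    · filter_upwards [hfA, (tendsto_const_sub_nhdsNE ρ z).eventually hfB, hhf z,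
        (tendsto_const_sub_nhdsNE ρ z).eventually (hhf (ρ - z)), self_mem_nhdsWithin]
        with w h1 h2 h3 h4 h5
      have hw : w - z ≠ 0 := sub_ne_zero.2 h5
      rw [h3, h4, h1, h2, levelDivisor_sub, show ρ - w - (ρ - z) = -(w - z) by ring]
      push_cast
      field_simp
      ring)
  have hc0 : c = 0 := by
    obtain ⟨w, h1, h2⟩ := ((hc z).and
      ((tendsto_const_sub_nhdsNE ρ z).eventually (hc (ρ - z)))).exists
    simp only [sub_sub_cancel] at h1 h2
    linear_combination -(1 / 2 : ℂ) * h1 - (1 / 2 : ℂ) * h2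
  filter_upwards [hc z] with w hw
  rw [hc0] at hw
  exact sub_eq_zero.1 hw

/-- The differential equation of `f` in terms of the logarithmic derivative `h = f' / f`. -/
lemma ode_logDeriv_eventuallyEq {h : ℂ → ℂ} {z : ℂ} (hh : h =ᶠ[𝓝[≠] z] logDeriv f)
    (hf : ∀ᶠ w in 𝓝[≠] z, AnalyticAt ℂ f w ∧ f w ≠ 0) (a b c : ℂ) :
    ∀ᶠ w in 𝓝[≠] z,
      deriv (deriv h) w - 2 * h w ^ 3 - 6 * a * h w ^ 2 - 12 * b * h w - 12 * c =
      (f w * deriv (deriv (deriv f)) w - 3 * deriv f w * deriv (deriv f) w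
        - (6 * a * deriv f w ^ 2 + 12 * b * (f w * deriv f w) + 12 * c * f w ^ 2)) / f w ^ 2 := by
  have h1 : deriv h =ᶠ[𝓝[≠] z]
      fun w => (deriv (deriv f) w * f w - deriv f w * deriv f w) / f w ^ 2 := by
    filter_upwards [hh.nhdsNE_deriv, hf] with w h2 ⟨h3, h4⟩
    rw [h2]
    exact (h3.deriv.differentiableAt.hasDerivAt.fun_div h3.differentiableAt.hasDerivAt h4).deriv
  filter_upwards [hh, h1.nhdsNE_deriv, hf] with w h2 h3 ⟨h4, h5⟩
  have d0 := h4.differentiableAt.hasDerivAt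
  have d1 := h4.deriv.differentiableAt.hasDerivAt
  have d2 := h4.deriv.deriv.differentiableAt.hasDerivAt
  rw [h3, h2, logDeriv_apply, (((d2.fun_mul d0).fun_sub (d1.fun_mul d1)).fun_div (d0.fun_pow 2)
    (pow_ne_zero 2 h5)).deriv]
  field_simp
  ring

/-- The Taylor series of the defect of the differential equation. -/
lemma taylorSeries_ode (hf : AnalyticAt ℂ f 0) (a b c : ℂ) :
    taylorSeries (fun w => f w * deriv (deriv (deriv f)) w - 3 * deriv f w * deriv (deriv f) w
        - (6 * a * deriv f w ^ 2 + 12 * b * (f w * deriv f w) + 12 * c * f w ^ 2)) =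
      odeDefect a b c (taylorSeries f) := by
  have d1 := hf.deriv
  have d2 := hf.deriv.deriv
  have d3 := hf.deriv.deriv.deriv
  rw [taylorSeries_sub (by fun_prop) (by fun_prop), taylorSeries_sub (by fun_prop) (by fun_prop),
    taylorSeries_add (by fun_prop) (by fun_prop), taylorSeries_add (by fun_prop) (by fun_prop),
    taylorSeries_mul hf d3, taylorSeries_mul (by fun_prop) d2,
    taylorSeries_mul (by fun_prop) d1, taylorSeries_const,
    taylorSeries_mul (by fun_prop) (by fun_prop), taylorSeries_const, taylorSeries_pow d1,
    taylorSeries_mul (by fun_prop) (by fun_prop), taylorSeries_const, taylorSeries_mul hf d1,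
    taylorSeries_mul (by fun_prop) (by fun_prop), taylorSeries_const, taylorSeries_pow hf,
    taylorSeries_deriv, taylorSeries_deriv, taylorSeries_deriv]
  have h3 : PowerSeries.C (3 : ℂ) = 3 := map_ofNat PowerSeries.C 3
  rw [h3]
  rfl

/-- Every elliptic function of level `N` satisfies the differential equation given by its
parameters. In terms of the logarithmic derivative `h = f' / f` the equation reads
`h'' = 2 h ^ 3 + 6 q₁ h ^ 2 + 12 q₂ h + 12 q₃`. The difference of both sides is elliptic; by the
choice of the parameters it vanishes at `0`, by the symmetry `z ↦ ρ - z` it has no pole at `ρ`,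
and there are no other poles. -/
theorem IsEllipticOfLevel.isSeriesSolution (hf : IsEllipticOfLevel L N f) {q : Fin 4 → ℂ}
    (hq : HasParameters q (taylorSeries f)) : IsSeriesSolution q (taylorSeries f) := by
  refine ⟨hq, satisfiesODE_iff.2 ?_⟩
  obtain ⟨ρ, h, hh, hhf, hord⟩ := hf.exists_logDeriv
  have hm : Meromorphic f := fun z => (hf.meromorphic (Set.mem_univ z)).meromorphicAt
  have hf0 := hf.analyticAt_zero
  have hne : ∀ z, ∀ᶠ w in 𝓝[≠] z, AnalyticAt ℂ f w ∧ f w ≠ 0 := fun z =>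
    (hm z).eventually_analyticAt.and
      ((meromorphicOrderAt_ne_top_iff_eventually_ne_zero (hm z)).1
        (by rw [hord]; exact WithTop.coe_ne_top))
  obtain ⟨B, hB, hEB⟩ := exists_eq_pow_mul_of_coeff_taylorSeries_eq_zero
    (f := fun w => f w * deriv (deriv (deriv f)) w - 3 * deriv f w * deriv (deriv f) w
        - (6 * q 0 * deriv f w ^ 2 + 12 * q 1 * (f w * deriv f w) + 12 * q 2 * f w ^ 2))
    (by
      have d1 := hf0.deriv
      have d2 := hf0.deriv.deriv
      have d3 := hf0.deriv.deriv.deriv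
      fun_prop) 3 (by
      rw [taylorSeries_ode hf0]
      exact coeff_odeDefect_eq_zero hq)
  obtain ⟨F, hF, hfF⟩ := exists_eq_pow_mul_of_coeff_taylorSeries_eq_zero hf0 1 (by
    intro i hi
    rw [Nat.lt_one_iff.1 hi]
    exact hf.coeff_taylorSeries.1)
  have hF0 : F 0 ≠ 0 := by
    have h1 : deriv f 0 = F 0 := by
      have h2 : f =ᶠ[𝓝 0] fun z => z ^ 1 * F z := hfF
      rw [h2.deriv_eq, (((hasDerivAt_pow 1 (0 : ℂ))).fun_mul hF.differentiableAt.hasDerivAt).deriv]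
      simp
    rw [← h1, hf.deriv_zero.deriv]
    exact one_ne_zero
  set D : ℂ → ℂ := fun w => deriv (deriv h) w - 2 * h w ^ 3 - 6 * q 0 * h w ^ 2 - 12 * q 1 * h w
    - 12 * q 2 with hDdef
  have hD : IsElliptic L D := ((((hh.deriv.deriv).sub ((hh.pow 3).const_mul 2)).sub
    ((hh.pow 2).const_mul (6 * q 0))).sub (hh.const_mul (12 * q 1))).sub (IsElliptic.const _)
  have hDE : ∀ z, ∀ᶠ w in 𝓝[≠] z, D w = (f w * deriv (deriv (deriv f)) w
      - 3 * deriv f w * deriv (deriv f) w - (6 * q 0 * deriv f w ^ 2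
        + 12 * q 1 * (f w * deriv f w) + 12 * q 2 * f w ^ 2)) / f w ^ 2 := fun z =>
    ode_logDeriv_eventuallyEq (hhf z) (hne z) (q 0) (q 1) (q 2)
  have hD0 : D =ᶠ[𝓝[≠] 0] fun w => w * (B w / F w ^ 2) := by
    filter_upwards [hDE 0, nhdsWithin_le_nhds hEB, nhdsWithin_le_nhds hfF, self_mem_nhdsWithin]
      with w h1 h2 h3 h4
    have hw : w ≠ 0 := h4
    rw [h1, h2, h3]
    field_simp
  have hA0 : AnalyticAt ℂ (fun w => w * (B w / F w ^ 2)) 0 :=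
    analyticAt_id.fun_mul (hB.fun_div (hF.fun_pow 2) (pow_ne_zero 2 hF0))
  have hlat : ∀ z ∈ L.lattice, 0 ≤ meromorphicOrderAt D z := fun z hz => by
    rw [hD.meromorphicOrderAt_of_mem hz]
    exact MeromorphicAt.order_nonneg_of_eventuallyEq hA0 hD0
  have hDnonneg : ∀ z, 0 ≤ meromorphicOrderAt D z := by
    intro z
    by_cases hz : z ∈ L.lattice
    · exact hlat z hz
    by_cases hzρ : z - ρ ∈ L.lattice
    · have hsym : (fun w => D (ρ - w)) =ᶠ[𝓝[≠] z] D := by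
        have h1 := logDeriv_symmetric hm hh hhf hord z
        have h2 : deriv (deriv fun w => h (ρ - w)) = fun w => deriv (deriv h) (ρ - w) := by
          have h3 : (deriv fun w => h (ρ - w)) = fun w => -deriv h (ρ - w) :=
            funext fun w => deriv_comp_const_sub ..
          rw [h3]
          funext w
          rw [deriv.fun_neg, deriv_comp_const_sub, neg_neg]
        have h3 := h1.nhdsNE_deriv.nhdsNE_deriv
        rw [h2] at h3
        filter_upwards [h1, h3] with w h4 h5
        simp only [hDdef]
        rw [h4, h5]
      rw [← meromorphicOrderAt_congr hsym]
      have h1 : (fun w => D (ρ - w)) = D ∘ fun w => ρ - w := rfl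
      have h2 : deriv (fun w : ℂ => ρ - w) z ≠ 0 := by
        rw [((hasDerivAt_id' z).const_sub ρ).deriv]
        simp
      rw [h1, meromorphicOrderAt_comp_of_deriv_ne_zero (by fun_prop) h2]
      exact hlat _ (by rwa [← neg_mem_iff, neg_sub])
    · have h0 : levelDivisor L ρ z = 0 := by
        classical
        simp [levelDivisor, hz, hzρ]
      obtain ⟨A, hA, hfA⟩ := exists_logDeriv_eventuallyEq (hm z) (hord z)
      rw [h0] at hfA
      have hhA : h =ᶠ[𝓝[≠] z] A := by
        filter_upwards [hhf z, hfA] with w h1 h2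
        rw [h1, h2]
        simp
      refine MeromorphicAt.order_nonneg_of_eventuallyEq (A := fun w => deriv (deriv A) w
        - 2 * A w ^ 3 - 6 * q 0 * A w ^ 2 - 12 * q 1 * A w - 12 * q 2) ?_ ?_
      · have := hA.deriv.deriv
        fun_prop
      · filter_upwards [hhA, hhA.nhdsNE_deriv.nhdsNE_deriv] with w h1 h2
        simp only [hDdef]
        rw [h1, h2]
  obtain ⟨c, hc⟩ := hD.exists_eventuallyEq_const hDnonneg
  have hc0 : c = 0 := by
    have h1 : Tendsto D (𝓝[≠] 0) (𝓝 c) := tendsto_const_nhds.congr' (hc 0).symm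
    have h2 : Tendsto D (𝓝[≠] 0) (𝓝 0) := by
      refine Tendsto.congr' hD0.symm
        (hA0.continuousAt.tendsto.mono_left nhdsWithin_le_nhds |>.trans ?_)
      simp
    exact tendsto_nhds_unique h1 h2
  rw [← taylorSeries_ode hf0]
  have hz : (fun w => f w * deriv (deriv (deriv f)) w - 3 * deriv f w * deriv (deriv f) w
        - (6 * q 0 * deriv f w ^ 2 + 12 * q 1 * (f w * deriv f w) + 12 * q 2 * f w ^ 2))
        =ᶠ[𝓝 0] fun _ => 0 := by
    refine (AnalyticAt.frequently_eq_iff_eventually_eq ?_ analyticAt_const).1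
      (Eventually.frequently ?_)
    · have d1 := hf0.deriv
      have d2 := hf0.deriv.deriv
      have d3 := hf0.deriv.deriv.deriv
      fun_prop
    · filter_upwards [hc 0, hDE 0, hne 0] with w h1 h2 ⟨_, h3⟩
      rw [h1, hc0, eq_comm, div_eq_zero_iff] at h2
      exact h2.resolve_right (pow_ne_zero 2 h3)
  rw [taylorSeries_congr hz, taylorSeries_const]
  exact _root_.map_zero PowerSeries.C

/-- The residues at `0` of `f ^ (-5)` and `f ^ (-5) (f' / f) ^ 2` vanish, for an elliptic function
`f` of level `5`: by the zero of `f ^ (-5)` of order `5` at `ρ`, these elliptic functions have poles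
only at lattice points. -/
theorem IsEllipticOfLevel.levelFive_equations (hf : IsEllipticOfLevel L 5 f) {q : Fin 4 → ℂ}
    (hq : IsSeriesSolution q (taylorSeries f)) :
    (q 0) ^ 4 + 6 * (q 0) ^ 2 * q 1 + 2 * (q 1) ^ 2 + 4 * q 0 * q 2 + q 3 = 0 ∧
      (11 * (q 0) ^ 2 + 3 * q 1) ^ 3 - 4 * (18 * (q 0) ^ 3 + 6 * q 0 * q 1 - q 2) ^ 2 = 0 := by
  obtain ⟨ρ, h, hh, hhf, hord⟩ := hf.exists_logDeriv
  have hm : Meromorphic f := fun z => (hf.meromorphic (Set.mem_univ z)).meromorphicAt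
  have hf0 := hf.analyticAt_zero
  obtain ⟨F, hF, hfF⟩ := exists_eq_pow_mul_of_coeff_taylorSeries_eq_zero hf0 1 (by
    intro i hi
    rw [Nat.lt_one_iff.1 hi]
    exact hf.coeff_taylorSeries.1)
  simp only [pow_one] at hfF
  have hF0 : F 0 ≠ 0 := by
    have h1 : deriv f 0 = F 0 := by
      have h2 : f =ᶠ[𝓝 0] fun z => z * F z := hfF
      rw [h2.deriv_eq, ((hasDerivAt_id' (0 : ℂ)).fun_mul hF.differentiableAt.hasDerivAt).deriv]
      simp
    rw [← h1, hf.deriv_zero.deriv]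
    exact one_ne_zero
  set Q : ℂ → ℂ := fun z => (F z)⁻¹ with hQdef
  have hQ : AnalyticAt ℂ Q 0 := hF.fun_inv hF0
  have hQf : taylorSeries Q * taylorSeries f = PowerSeries.X := by
    rw [← taylorSeries_mul hQ hf0, ← taylorSeries_id]
    refine taylorSeries_congr ?_
    filter_upwards [hfF, hF.continuousAt.eventually_ne hF0] with z h1 h2
    rw [h1, hQdef]
    field_simp
  have hu : IsElliptic L fun z => (f z ^ 5)⁻¹ := by
    obtain ⟨_, hper, _⟩ := hf.power
    exact IsElliptic.inv ⟨hm.pow, fun ω hω z => hper ω hω z⟩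
  -- orders away from the lattice
  have hdiv : ∀ z ∉ L.lattice,
      meromorphicOrderAt f z = 0 ∨ meromorphicOrderAt f z = (-1 : ℤ) := by
    intro z hz
    rw [hord z]
    classical
    by_cases hzρ : z - ρ ∈ L.lattice
    · right; simp [levelDivisor, hz, hzρ]
    · left; simp [levelDivisor, hz, hzρ]
  have hu0 : ∀ᶠ z in 𝓝[≠] (0 : ℂ), (f z ^ 5)⁻¹ = (z ^ 5)⁻¹ * Q z ^ 5 := by
    filter_upwards [nhdsWithin_le_nhds hfF] with z h1
    rw [h1, hQdef]
    simp [mul_pow, mul_comm]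
  have h4 : PowerSeries.coeff 4 (taylorSeries Q ^ 5) = 0 := by
    rw [← taylorSeries_pow hQ]
    refine hu.coeff_taylorSeries_eq_zero 4 (fun z hz => ?_) (hQ.fun_pow 5) hu0
    rw [fun_meromorphicOrderAt_inv, fun_meromorphicOrderAt_pow (hm z)]
    rcases hdiv z hz with h1 | h1 <;> rw [h1]
    · simp
    · decide
  have h6 : PowerSeries.coeff 6 (taylorSeries Q ^ 3 *
      (taylorSeries Q - PowerSeries.X * PowerSeries.derivative ℂ (taylorSeries Q)) ^ 2) = 0 := by
    have hG : AnalyticAt ℂ (fun z => z * deriv Q z) 0 := analyticAt_id.fun_mul hQ.deriv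
    rw [← taylorSeries_deriv, ← taylorSeries_id, ← taylorSeries_mul (by fun_prop) hQ.deriv,
      ← taylorSeries_sub hQ hG, ← taylorSeries_pow hQ, ← taylorSeries_pow (hQ.fun_sub hG),
      ← taylorSeries_mul (hQ.fun_pow 3) ((hQ.fun_sub hG).fun_pow 2)]
    refine (hu.mul (hh.pow 2)).coeff_taylorSeries_eq_zero 6 (fun z hz => ?_)
      ((hQ.fun_pow 3).fun_mul ((hQ.fun_sub hG).fun_pow 2)) ?_
    · rw [fun_meromorphicOrderAt_mul (hu.meromorphic z) ((hh.pow 2).meromorphic z),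
        fun_meromorphicOrderAt_inv, fun_meromorphicOrderAt_pow (hm z),
        fun_meromorphicOrderAt_pow (hh.meromorphic z), meromorphicOrderAt_congr (hhf z)]
      rcases hdiv z hz with h1 | h1
      · have h2 := meromorphicOrderAt_logDeriv_nonneg (hm z) h1
        rw [h1]
        simp only [mul_zero, neg_zero, zero_add, Nat.cast_ofNat]
        generalize meromorphicOrderAt (logDeriv f) z = o at h2
        cases o with
        | top => decide
        | coe m =>
          have h3 : 0 ≤ m := by exact_mod_cast h2
          rw [show (2 : WithTop ℤ) * (m : WithTop ℤ) = ((2 * m : ℤ) : WithTop ℤ) from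
            (WithTop.coe_mul 2 m).symm]
          exact_mod_cast (mul_nonneg zero_le_two h3 : (0 : ℤ) ≤ 2 * m)
      · rw [h1, meromorphicOrderAt_logDeriv_eq_neg_one (hm z) (by rw [h1]; decide)
          (by rw [h1]; decide)]
        decide
    · have hlog : logDeriv f =ᶠ[𝓝[≠] 0] fun z => z⁻¹ - deriv Q z / Q z := by
        have h1 : f =ᶠ[𝓝[≠] 0] fun z => z * F z := nhdsWithin_le_nhds hfF
        filter_upwards [logDeriv_congr_nhdsNE h1, nhdsWithin_le_nhds hF.eventually_analyticAt,
          nhdsWithin_le_nhds (hF.continuousAt.eventually_ne hF0), self_mem_nhdsWithin]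
          with z h2 h3 h4 h5
        have hz : z ≠ 0 := h5
        have dF := h3.differentiableAt.hasDerivAt
        rw [h2, logDeriv_apply, ((hasDerivAt_id' z).fun_mul dF).deriv, hQdef,
          (dF.fun_inv h4).deriv]
        field_simp
        ring
      filter_upwards [hu0, hhf 0, hlog, nhdsWithin_le_nhds (hF.continuousAt.eventually_ne hF0),
        self_mem_nhdsWithin] with z h1 h2 h3 h4 h5
      have hz : z ≠ 0 := h5
      have hQz : Q z ≠ 0 := inv_ne_zero h4
      rw [h1, h2, h3]
      field_simp
      ring
  exact Hirzebruch.levelFive_equations hq hQf h4 h6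

end Hirzebruch

/-! ### Elliptic functions of level `5` from theta products -/

namespace Hirzebruch

/-- The infinite product `∏ (1 - w q ^ n)` over `n ≥ 0`. -/
noncomputable def qProduct (q w : ℂ) : ℂ := ∏' n : ℕ, (1 + -(w * q ^ n))

section qProduct

variable {q : ℂ}

lemma summable_norm_mul_pow (hq : ‖q‖ < 1) (w : ℂ) : Summable fun n : ℕ => ‖-(w * q ^ n)‖ := by
  simp only [norm_neg, norm_mul, norm_pow]
  exact (summable_geometric_of_lt_one (norm_nonneg _) hq).mul_left _

lemma qProduct_eq_mul (hq : ‖q‖ < 1) (w : ℂ) :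
    qProduct q w = (1 - w) * qProduct q (w * q) := by
  have h : Multipliable fun n : ℕ => 1 + -(w * q ^ (n + 1)) := by
    refine multipliable_one_add_of_summable ?_
    refine (summable_norm_mul_pow hq (w * q)).congr fun n => ?_
    rw [pow_succ', mul_assoc]
  have h2 : ∀ n : ℕ, 1 + -(w * q ^ (n + 1)) = 1 + -(w * q * q ^ n) := fun n => by ring
  have h3 := tprod_eq_zero_mul' (f := fun n : ℕ => 1 + -(w * q ^ n)) h
  rw [tprod_congr h2, pow_zero, mul_one, ← sub_eq_add_neg] at h3
  exact h3

lemma qProduct_ne_zero (hq : ‖q‖ < 1) {w : ℂ} (hw : ∀ n : ℕ, w * q ^ n ≠ 1) :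
    qProduct q w ≠ 0 := by
  refine tprod_one_add_ne_zero_of_summable (fun n h => hw n ?_) (summable_norm_mul_pow hq w)
  linear_combination -h

lemma differentiable_qProduct (hq : ‖q‖ < 1) : Differentiable ℂ (qProduct q) := by
  intro w
  have hU : IsOpen (Metric.ball (0 : ℂ) (‖w‖ + 1)) := Metric.isOpen_ball
  have hp : HasProdLocallyUniformlyOn (fun (n : ℕ) (w : ℂ) => 1 + -(w * q ^ n))
      (fun w => ∏' n : ℕ, (1 + -(w * q ^ n))) (Metric.ball (0 : ℂ) (‖w‖ + 1)) := by
    refine Summable.hasProdLocallyUniformlyOn_nat_one_add hU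
      (u := fun n => (‖w‖ + 1) * ‖q‖ ^ n)
      ((summable_geometric_of_lt_one (norm_nonneg _) hq).mul_left _)
      (.of_forall fun n x hx => ?_) (fun n => by fun_prop)
    rw [norm_neg, norm_mul, norm_pow]
    gcongr
    simpa using (mem_ball_zero_iff.1 hx).le
  refine (hp.differentiableOn (.of_forall fun s => ?_) hU).differentiableAt
    (hU.mem_nhds (by simp))
  simpa [Finset.prod_fn] using DifferentiableOn.finsetProd (fun _ _ => by fun_prop)

end qProduct

/-- The function `z ↦ exp (2 π i z)`. -/
noncomputable def expTwoPiI (z : ℂ) : ℂ := Complex.exp (2 * Real.pi * Complex.I * z)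

lemma expTwoPiI_add (z w : ℂ) : expTwoPiI (z + w) = expTwoPiI z * expTwoPiI w := by
  rw [expTwoPiI, mul_add, Complex.exp_add]
  rfl

lemma expTwoPiI_ne_zero (z : ℂ) : expTwoPiI z ≠ 0 := Complex.exp_ne_zero _

lemma expTwoPiI_eq_one_iff {z : ℂ} : expTwoPiI z = 1 ↔ ∃ n : ℤ, z = n := by
  have h : (2 * Real.pi * Complex.I : ℂ) ≠ 0 := by simp [Real.pi_ne_zero]
  rw [expTwoPiI, Complex.exp_eq_one_iff]
  refine exists_congr fun n => ⟨fun h1 => mul_left_cancel₀ h (by rw [h1]; ring), ?_⟩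
  rintro rfl
  ring

lemma expTwoPiI_one : expTwoPiI 1 = 1 := expTwoPiI_eq_one_iff.2 ⟨1, by simp⟩

lemma expTwoPiI_mul_nat (z : ℂ) (n : ℕ) : expTwoPiI (n * z) = expTwoPiI z ^ n := by
  rw [expTwoPiI, expTwoPiI, ← Complex.exp_nat_mul]
  congr 1
  ring

lemma norm_expTwoPiI_lt_one {τ : ℂ} (hτ : 0 < τ.im) : ‖expTwoPiI τ‖ < 1 := by
  rw [expTwoPiI, Complex.norm_exp, Real.exp_lt_one_iff]
  simp only [Complex.mul_re, Complex.mul_im, Complex.I_re, Complex.I_im, Complex.ofReal_re,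
    Complex.ofReal_im, Complex.re_ofNat, Complex.im_ofNat]
  have := Real.pi_pos
  ring_nf
  nlinarith [mul_pos this hτ]

lemma differentiable_expTwoPiI : Differentiable ℂ expTwoPiI := by
  unfold expTwoPiI
  fun_prop

/-- The product form of a theta function: an entire function with simple zeros at the points of
`ℤ + ℤ τ`. -/
noncomputable def thetaProduct (τ z : ℂ) : ℂ :=
  qProduct (expTwoPiI τ) (expTwoPiI z) * qProduct (expTwoPiI τ) (expTwoPiI τ * (expTwoPiI z)⁻¹)

section theta

variable {τ : ℂ}

lemma differentiable_thetaProduct (hτ : 0 < τ.im) : Differentiable ℂ (thetaProduct τ) := by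
  have h := differentiable_qProduct (norm_expTwoPiI_lt_one hτ)
  have he := differentiable_expTwoPiI
  refine (h.comp he).mul (h.comp ((differentiable_const _).mul fun z => ?_))
  exact (he z).inv (expTwoPiI_ne_zero z)

lemma thetaProduct_add_one (z : ℂ) : thetaProduct τ (z + 1) = thetaProduct τ z := by
  rw [thetaProduct, expTwoPiI_add, expTwoPiI_one, mul_one]
  rfl

lemma thetaProduct_eq_mul (hτ : 0 < τ.im) (z : ℂ) : thetaProduct τ z = (1 - expTwoPiI z) *
    (qProduct (expTwoPiI τ) (expTwoPiI z * expTwoPiI τ) *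
      qProduct (expTwoPiI τ) (expTwoPiI τ * (expTwoPiI z)⁻¹)) := by
  rw [thetaProduct, qProduct_eq_mul (norm_expTwoPiI_lt_one hτ), mul_assoc]

lemma thetaProduct_add_tau (hτ : 0 < τ.im) (z : ℂ) :
    thetaProduct τ (z + τ) = -(expTwoPiI z)⁻¹ * thetaProduct τ z := by
  have hw := expTwoPiI_ne_zero z
  have hq := expTwoPiI_ne_zero τ
  have h1 : expTwoPiI τ * (expTwoPiI z * expTwoPiI τ)⁻¹ = (expTwoPiI z)⁻¹ := by field_simp
  rw [thetaProduct_eq_mul hτ z, thetaProduct, expTwoPiI_add, h1,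
    qProduct_eq_mul (norm_expTwoPiI_lt_one hτ) (expTwoPiI z)⁻¹, mul_comm (expTwoPiI z)⁻¹]
  field_simp
  ring

lemma exists_of_thetaProduct_eq_zero (hτ : 0 < τ.im) {z : ℂ} (hz : thetaProduct τ z = 0) :
    ∃ m n : ℤ, m + n * τ = z := by
  by_contra! h
  refine mul_ne_zero (qProduct_ne_zero (norm_expTwoPiI_lt_one hτ) fun n hn => ?_)
    (qProduct_ne_zero (norm_expTwoPiI_lt_one hτ) fun n hn => ?_) hz
  · rw [← expTwoPiI_mul_nat, ← expTwoPiI_add, expTwoPiI_eq_one_iff] at hn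
    obtain ⟨m, hm⟩ := hn
    refine h m (-n) ?_
    push_cast
    linear_combination -hm
  · have h1 : expTwoPiI (n * τ + τ) = expTwoPiI z := by
      rw [expTwoPiI_add, expTwoPiI_mul_nat]
      have := expTwoPiI_ne_zero z
      field_simp at hn
      linear_combination hn
    have h2 : expTwoPiI (n * τ + τ - z) = 1 := by
      have h3 := expTwoPiI_add (n * τ + τ - z) z
      rw [sub_add_cancel, h1] at h3
      exact mul_right_cancel₀ (expTwoPiI_ne_zero z) (by rw [← h3, one_mul])
    obtain ⟨m, hm⟩ := expTwoPiI_eq_one_iff.1 h2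
    refine h (-m) (n + 1) ?_
    push_cast
    linear_combination hm

lemma thetaProduct_zero (hτ : 0 < τ.im) : thetaProduct τ 0 = 0 := by
  rw [thetaProduct_eq_mul hτ, expTwoPiI, mul_zero, Complex.exp_zero, sub_self, zero_mul]

lemma deriv_thetaProduct_zero_ne_zero (hτ : 0 < τ.im) : deriv (thetaProduct τ) 0 ≠ 0 := by
  have hE : expTwoPiI 0 = 1 := by simp [expTwoPiI]
  have h := differentiable_qProduct (norm_expTwoPiI_lt_one hτ)
  have he := differentiable_expTwoPiI
  set G : ℂ → ℂ := fun z => qProduct (expTwoPiI τ) (expTwoPiI z * expTwoPiI τ) *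
      qProduct (expTwoPiI τ) (expTwoPiI τ * (expTwoPiI z)⁻¹) with hG
  have hGd : Differentiable ℂ G := by
    refine (h.comp (he.mul (differentiable_const _))).mul
      (h.comp ((differentiable_const _).mul fun z => ?_))
    exact (he z).inv (expTwoPiI_ne_zero z)
  have hG0 : G 0 ≠ 0 := by
    have h1 : qProduct (expTwoPiI τ) (expTwoPiI τ) ≠ 0 := by
      refine qProduct_ne_zero (norm_expTwoPiI_lt_one hτ) fun n hn => ?_
      have h2 := congrArg norm hn
      rw [← pow_succ', norm_pow, norm_one] at h2
      exact (pow_lt_one₀ (norm_nonneg _) (norm_expTwoPiI_lt_one hτ) n.succ_ne_zero).ne h2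
    simp only [hG, hE, one_mul, inv_one, mul_one]
    exact mul_ne_zero h1 h1
  have h1 : thetaProduct τ = fun z => (1 - expTwoPiI z) * G z :=
    funext fun z => thetaProduct_eq_mul hτ z
  have h2 : HasDerivAt expTwoPiI (2 * Real.pi * Complex.I) 0 := by
    have := ((hasDerivAt_id' (0 : ℂ)).const_mul (2 * Real.pi * Complex.I : ℂ)).cexp
    simpa using! this
  rw [h1, ((h2.const_sub 1).fun_mul (hGd 0).hasDerivAt).deriv, hE]
  simp [Real.pi_ne_zero, hG0]

lemma meromorphicOrderAt_thetaProduct_zero (hτ : 0 < τ.im) :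
    meromorphicOrderAt (thetaProduct τ) 0 = 1 := by
  have ha : AnalyticAt ℂ (thetaProduct τ) 0 := (differentiable_thetaProduct hτ).analyticAt 0
  have h := ha.analyticOrderAt_sub_eq_one_of_deriv_ne_zero (deriv_thetaProduct_zero_ne_zero hτ)
  simp only [thetaProduct_zero hτ, sub_zero] at h
  rw [ha.meromorphicOrderAt_eq, h]
  rfl

end theta

/-- The pair of periods `1`, `τ`. -/
noncomputable def tauPeriods (τ : ℂ) (hτ : 0 < τ.im) : PeriodPair where
  ω₁ := 1
  ω₂ := τ
  indep := by
    refine LinearIndependent.pair_iff.2 fun s t h => ?_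
    have him := congrArg Complex.im h
    have hre := congrArg Complex.re h
    simp only [Complex.real_smul, Complex.add_im, Complex.mul_im, Complex.ofReal_re,
      Complex.ofReal_im, Complex.one_im, Complex.add_re, Complex.mul_re, Complex.one_re,
      Complex.zero_re, Complex.zero_im] at him hre
    have ht : t = 0 := by
      have : t * τ.im = 0 := by linarith
      exact (mul_eq_zero.1 this).resolve_right hτ.ne'
    subst ht
    exact ⟨by linarith, rfl⟩

section levelFive

variable {τ : ℂ}

lemma mem_tauPeriods (hτ : 0 < τ.im) {z : ℂ} :
    z ∈ (tauPeriods τ hτ).lattice ↔ ∃ m n : ℤ, m + n * τ = z := by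
  rw [PeriodPair.mem_lattice]
  simp [tauPeriods]

lemma ofReal_mem_tauPeriods (hτ : 0 < τ.im) {x : ℝ} (hx : (x : ℂ) ∈ (tauPeriods τ hτ).lattice) :
    ∃ m : ℤ, x = m := by
  obtain ⟨m, n, h⟩ := (mem_tauPeriods hτ).1 hx
  have him := congrArg Complex.im h
  have hre := congrArg Complex.re h
  simp only [Complex.add_im, Complex.mul_im, Complex.intCast_re, Complex.intCast_im,
    Complex.ofReal_im, Complex.add_re, Complex.mul_re, Complex.ofReal_re] at him hre
  have hn : (n : ℝ) = 0 := by
    have : (n : ℝ) * τ.im = 0 := by linarith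
    exact (mul_eq_zero.1 this).resolve_right hτ.ne'
  rw [hn] at hre
  exact ⟨m, by linarith⟩

lemma thetaProduct_ne_zero (hτ : 0 < τ.im) {z : ℂ} (hz : z ∉ (tauPeriods τ hτ).lattice) :
    thetaProduct τ z ≠ 0 := fun h =>
  hz ((mem_tauPeriods hτ).2 (exists_of_thetaProduct_eq_zero hτ h))

lemma fifth_notMem (hτ : 0 < τ.im) : (1 / 5 : ℂ) ∉ (tauPeriods τ hτ).lattice := by
  intro h
  obtain ⟨m, hm⟩ := ofReal_mem_tauPeriods hτ (x := 1 / 5) (by simpa using h)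
  have h5 : (5 * m : ℤ) = 1 := by
    have : (5 * m : ℝ) = 1 := by rw [← hm]; norm_num
    exact_mod_cast this
  omega

lemma two_fifths_notMem (hτ : 0 < τ.im) : (2 / 5 : ℂ) ∉ (tauPeriods τ hτ).lattice := by
  intro h
  obtain ⟨m, hm⟩ := ofReal_mem_tauPeriods hτ (x := 2 / 5) (by simpa using h)
  have h5 : (5 * m : ℤ) = 2 := by
    have : (5 * m : ℝ) = 2 := by rw [← hm]; norm_num
    exact_mod_cast this
  omega

/-- The function `θ(z) / θ(z - 1/5)`, normalized to have derivative `1` at `0`. -/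
noncomputable def levelFiveFunction (τ z : ℂ) : ℂ :=
  thetaProduct τ (-(1 / 5)) / deriv (thetaProduct τ) 0 *
    (thetaProduct τ z / thetaProduct τ (z - 1 / 5))

lemma levelFiveFunction_add_one (z : ℂ) :
    levelFiveFunction τ (z + 1) = levelFiveFunction τ z := by
  rw [levelFiveFunction, levelFiveFunction, thetaProduct_add_one,
    show z + 1 - 1 / 5 = z - 1 / 5 + 1 by ring, thetaProduct_add_one]

lemma levelFiveFunction_add_tau (hτ : 0 < τ.im) (z : ℂ) :
    levelFiveFunction τ (z + τ) = (expTwoPiI (1 / 5))⁻¹ * levelFiveFunction τ z := by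
  rw [levelFiveFunction, levelFiveFunction, thetaProduct_add_tau hτ,
    show z + τ - 1 / 5 = z - 1 / 5 + τ by ring, thetaProduct_add_tau hτ]
  have h1 : expTwoPiI z = expTwoPiI (z - 1 / 5) * expTwoPiI (1 / 5) := by
    rw [← expTwoPiI_add, sub_add_cancel]
  have h2 := expTwoPiI_ne_zero (z - 1 / 5)
  have h3 := expTwoPiI_ne_zero (1 / 5)
  rw [h1]
  generalize thetaProduct τ (z - 1 / 5) = B
  generalize expTwoPiI (z - 1 / 5) = A at h2
  generalize expTwoPiI (1 / 5) = A' at h3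
  by_cases h4 : B = 0
  · simp [h4]
  · field_simp

lemma expTwoPiI_fifth_pow : expTwoPiI (1 / 5) ^ 5 = 1 := by
  rw [← expTwoPiI_mul_nat, expTwoPiI_eq_one_iff]
  exact ⟨1, by norm_num⟩

lemma levelFiveFunction_const_ne_zero (hτ : 0 < τ.im) :
    thetaProduct τ (-(1 / 5)) / deriv (thetaProduct τ) 0 ≠ 0 :=
  div_ne_zero (thetaProduct_ne_zero hτ (by rw [neg_mem_iff]; exact fifth_notMem hτ))
    (deriv_thetaProduct_zero_ne_zero hτ)

lemma meromorphicNFAt_levelFiveFunction (hτ : 0 < τ.im) (z : ℂ) :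
    MeromorphicNFAt (levelFiveFunction τ) z := by
  have hd := differentiable_thetaProduct hτ
  have hd' : Differentiable ℂ fun w => thetaProduct τ (w - 1 / 5) :=
    hd.comp (differentiable_id.sub_const _)
  have h1 : MeromorphicNFAt (thetaProduct τ / fun w => thetaProduct τ (w - 1 / 5)) z := by
    refine MeromorphicNFOn.div (hd.analyticAt z) (hd'.analyticAt z).meromorphicNFAt ?_
    by_contra! h
    have m1 := (mem_tauPeriods hτ).2 (exists_of_thetaProduct_eq_zero hτ h.1)
    have m2 := (mem_tauPeriods hτ).2 (exists_of_thetaProduct_eq_zero hτ h.2)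
    have m3 := sub_mem m2 m1
    rw [sub_sub_cancel] at m3
    exact fifth_notMem hτ m3
  exact (meromorphicNFAt_mul_iff_right analyticAt_const (levelFiveFunction_const_ne_zero hτ)).2 h1

lemma hasDerivAt_levelFiveFunction (hτ : 0 < τ.im) :
    HasDerivAt (levelFiveFunction τ) 1 0 := by
  have hd := differentiable_thetaProduct hτ
  have h0 := deriv_thetaProduct_zero_ne_zero hτ
  have h1 : thetaProduct τ (0 - 1 / 5) ≠ 0 := by
    rw [zero_sub]
    exact thetaProduct_ne_zero hτ (by rw [neg_mem_iff]; exact fifth_notMem hτ)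
  have h := (((hd 0).hasDerivAt).fun_div ((hd (0 - 1 / 5)).hasDerivAt.comp_sub_const 0 (1 / 5))
    h1).const_mul (thetaProduct τ (-(1 / 5)) / deriv (thetaProduct τ) 0)
  refine h.congr_deriv ?_
  rw [thetaProduct_zero hτ]
  rw [zero_sub] at h1 ⊢
  field_simp
  ring

/-- The function `levelFiveFunction τ` is elliptic of level `5`: translation by `τ` multiplies it by
a primitive fifth root of unity. -/
theorem isEllipticOfLevel_levelFiveFunction (hτ : 0 < τ.im) :
    IsEllipticOfLevel (tauPeriods τ hτ) 5 (levelFiveFunction τ) := by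
  have hd := differentiable_thetaProduct hτ
  have hNF := meromorphicNFAt_levelFiveFunction hτ
  have hm : Meromorphic (levelFiveFunction τ) := fun z => (hNF z).meromorphicAt
  have hper : ∀ ω ∈ (tauPeriods τ hτ).lattice, ∀ z,
      levelFiveFunction τ (z + ω) ^ 5 = levelFiveFunction τ z ^ 5 := by
    have p1 : Function.Periodic (fun z => levelFiveFunction τ z ^ 5) 1 := fun z => by
      simp only [levelFiveFunction_add_one]
    have p2 : Function.Periodic (fun z => levelFiveFunction τ z ^ 5) τ := fun z => by
      simp only [levelFiveFunction_add_tau hτ]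
      rw [mul_pow, inv_pow, expTwoPiI_fifth_pow, inv_one, one_mul]
    intro ω hω z
    obtain ⟨m, n, rfl⟩ := (mem_tauPeriods hτ).1 hω
    have h1 := (p1.int_mul m).add_period (p2.int_mul n) z
    simpa using h1
  have hE : IsElliptic (tauPeriods τ hτ) fun z => levelFiveFunction τ z ^ 5 :=
    ⟨hm.pow, hper⟩
  have hord0 : meromorphicOrderAt (fun z => levelFiveFunction τ z ^ 5) 0 =
      ((5 : ℤ) : WithTop ℤ) := by
    have h := hasDerivAt_levelFiveFunction hτ
    have ha := (hm 0).analyticAt h.continuousAt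
    have h0 : levelFiveFunction τ 0 = 0 := by simp [levelFiveFunction, thetaProduct_zero hτ]
    have h1 := ha.analyticOrderAt_sub_eq_one_of_deriv_ne_zero (by rw [h.deriv]; exact one_ne_zero)
    simp only [h0, sub_zero] at h1
    rw [fun_meromorphicOrderAt_pow (hm 0), ha.meromorphicOrderAt_eq, h1]
    rfl
  have hordc : ∀ z, meromorphicOrderAt (levelFiveFunction τ) z =
      meromorphicOrderAt (thetaProduct τ) z - meromorphicOrderAt (thetaProduct τ) (z - 1 / 5) := by
    intro z
    have h1 : meromorphicOrderAt
        (fun _ : ℂ => thetaProduct τ (-(1 / 5)) / deriv (thetaProduct τ) 0) z = 0 := by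
      classical
      rw [meromorphicOrderAt_const, if_neg (levelFiveFunction_const_ne_zero hτ)]
    have h2 : MeromorphicAt (fun w => thetaProduct τ (w - 1 / 5)) z :=
      ((hd.comp (differentiable_id.sub_const (1 / 5))).analyticAt z).meromorphicAt
    have h3 := (hd.analyticAt z).meromorphicAt
    unfold levelFiveFunction
    rw [fun_meromorphicOrderAt_mul (MeromorphicAt.const _ _) (h3.fun_div h2), h1, zero_add,
      fun_meromorphicOrderAt_div h3 h2, meromorphicOrderAt_fun_comp_sub_const_eq_meromorphicOrderAt]
  have hth0 : ∀ z ∉ (tauPeriods τ hτ).lattice, meromorphicOrderAt (thetaProduct τ) z = 0 :=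
    fun z hz => by
      rw [((hd.analyticAt z).meromorphicNFAt).meromorphicOrderAt_eq_zero_iff]
      exact thetaProduct_ne_zero hτ hz
  have hordρ : meromorphicOrderAt (fun z => levelFiveFunction τ z ^ 5) (1 / 5) =
      ((-5 : ℤ) : WithTop ℤ) := by
    rw [fun_meromorphicOrderAt_pow (hm _), hordc, hth0 _ (fifth_notMem hτ), sub_self,
      meromorphicOrderAt_thetaProduct_zero hτ]
    rfl
  refine ⟨fun z _ => hNF z, by simp [levelFiveFunction, thetaProduct_zero hτ],
    hasDerivAt_levelFiveFunction hτ, by norm_num, ⟨1 / 5, hper, fun z => ?_⟩, ?_⟩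
  · classical
    by_cases h1 : z ∈ (tauPeriods τ hτ).lattice
    · have h2 : z - 1 / 5 ∉ (tauPeriods τ hτ).lattice := fun h2 => by
        have h3 := sub_mem h1 h2
        rw [sub_sub_cancel] at h3
        exact fifth_notMem hτ h3
      rw [hE.meromorphicOrderAt_of_mem h1, hord0]
      simp only [Set.indicator_apply, Set.mem_ofPred_eq, if_pos h1, if_neg h2]
      rfl
    · by_cases h2 : z - 1 / 5 ∈ (tauPeriods τ hτ).lattice
      · have h3 := hE.meromorphicOrderAt_add h2 (1 / 5)
        rw [add_sub_cancel] at h3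
        rw [h3, hordρ]
        simp only [Set.indicator_apply, Set.mem_ofPred_eq, if_neg h1, if_pos h2]
        rfl
      · rw [fun_meromorphicOrderAt_pow (hm z), hordc, hth0 z h1, hth0 _ h2]
        simp only [Set.indicator_apply, Set.mem_ofPred_eq, if_neg h1, if_neg h2]
        simp
  -- `f ^ m` is `τ`-periodic only if `exp (2 π i / 5) ^ m = 1`, as seen at `2 / 5`, where `f ≠ 0`
  · rintro m hm0 ⟨_, hp, _⟩
    have h1 := hp τ ((mem_tauPeriods hτ).2 ⟨0, 1, by simp⟩) (2 / 5)
    have hne : levelFiveFunction τ (2 / 5) ≠ 0 := by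
      refine mul_ne_zero (levelFiveFunction_const_ne_zero hτ)
        (div_ne_zero (thetaProduct_ne_zero hτ (two_fifths_notMem hτ)) ?_)
      rw [show (2 / 5 - 1 / 5 : ℂ) = 1 / 5 by norm_num]
      exact thetaProduct_ne_zero hτ (fifth_notMem hτ)
    rw [levelFiveFunction_add_tau hτ, mul_pow, inv_pow] at h1
    have h2 : expTwoPiI (1 / 5) ^ m = 1 := by
      have h3 := mul_right_cancel₀ (pow_ne_zero m hne) (h1.trans (one_mul _).symm)
      rwa [inv_eq_one] at h3
    rw [← expTwoPiI_mul_nat, expTwoPiI_eq_one_iff] at h2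
    obtain ⟨k, hk⟩ := h2
    have h4 : (m : ℤ) = 5 * k := by
      have : (m : ℂ) = 5 * k := by rw [← hk]; ring
      exact_mod_cast this
    omega

end levelFive

end Hirzebruch

/-! ### Homotheties, and recovering the lattice from the parameters -/

namespace Hirzebruch

/-- The image of a pair of periods under the homothety `z ↦ c z`. -/
noncomputable def scalePeriods (L : PeriodPair) {c : ℂ} (hc : c ≠ 0) : PeriodPair where
  ω₁ := c * L.ω₁
  ω₂ := c * L.ω₂
  indep := by
    refine LinearIndependent.pair_iff.2 fun s t h => ?_
    refine LinearIndependent.pair_iff.1 L.indep s t (mul_left_cancel₀ hc ?_)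
    rw [mul_zero, ← h, mul_add, mul_smul_comm, mul_smul_comm]

lemma mem_scalePeriods {L : PeriodPair} {c : ℂ} (hc : c ≠ 0) {z : ℂ} :
    z ∈ (scalePeriods L hc).lattice ↔ c⁻¹ * z ∈ L.lattice := by
  rw [PeriodPair.mem_lattice, PeriodPair.mem_lattice]
  refine exists_congr fun m => exists_congr fun n => ?_
  simp only [scalePeriods]
  rw [eq_inv_mul_iff_mul_eq₀ hc]
  constructor <;> rintro rfl <;> ring

lemma scalePeriods_scalePeriods_inv (L : PeriodPair) {c : ℂ} (hc : c ≠ 0) :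
    scalePeriods (scalePeriods L hc) (inv_ne_zero hc) = L := by
  cases L
  simp [scalePeriods, hc]

/-- The conjugate of `f` by the homothety `z ↦ c z`. -/
noncomputable def scaleFun (c : ℂ) (f : ℂ → ℂ) (z : ℂ) : ℂ := c * f (c⁻¹ * z)

lemma scaleFun_scaleFun_inv {c : ℂ} (hc : c ≠ 0) (f : ℂ → ℂ) :
    scaleFun c⁻¹ (scaleFun c f) = f := by
  ext z
  simp [scaleFun, hc]

variable {L : PeriodPair} {N : ℕ} {f : ℂ → ℂ} {c : ℂ}

lemma HasPowerWithDivisor.scale (hc : c ≠ 0) (h : HasPowerWithDivisor L N f) :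
    HasPowerWithDivisor (scalePeriods L hc) N (scaleFun c f) := by
  obtain ⟨ρ, hper, hord⟩ := h
  refine ⟨c * ρ, fun ω hω z => ?_, fun z => ?_⟩
  · rw [scaleFun, scaleFun, mul_pow, mul_pow, mul_add, hper _ ((mem_scalePeriods hc).1 hω)]
  · have h1 : (fun w => scaleFun c f w ^ N) =
        (fun _ => c ^ N) * ((fun w => f w ^ N) ∘ fun w => c⁻¹ * w) := by
      ext w
      simp [scaleFun, mul_pow]
    have h2 : deriv (fun w => c⁻¹ * w) z ≠ 0 := by
      rw [((hasDerivAt_id' z).const_mul c⁻¹).deriv]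
      simpa using hc
    rw [h1, meromorphicOrderAt_mul_of_ne_zero analyticAt_const (pow_ne_zero N hc),
      meromorphicOrderAt_comp_of_deriv_ne_zero (by fun_prop) h2, hord]
    classical
    have h3 : c⁻¹ * z - ρ ∈ L.lattice ↔ z - c * ρ ∈ (scalePeriods L hc).lattice := by
      rw [mem_scalePeriods hc, mul_sub, inv_mul_cancel_left₀ hc]
    simp only [Set.indicator_apply, Set.mem_ofPred_eq, ← mem_scalePeriods hc, h3]

lemma IsEllipticOfLevel.scale (hc : c ≠ 0) (h : IsEllipticOfLevel L N f) :
    IsEllipticOfLevel (scalePeriods L hc) N (scaleFun c f) where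
  meromorphic := fun z _ => by
    have h1 : MeromorphicNFAt (f ∘ fun z => c⁻¹ * z) z :=
      (h.meromorphic (Set.mem_univ (c⁻¹ * z))).comp_analyticAt (by fun_prop)
    exact (meromorphicNFAt_mul_iff_right analyticAt_const hc).2 h1
  map_zero := by simp [scaleFun, h.map_zero]
  deriv_zero := by
    have h0 : HasDerivAt f 1 (c⁻¹ * 0) := by simpa using h.deriv_zero
    have h1 := (h0.comp 0 ((hasDerivAt_id' (0 : ℂ)).const_mul c⁻¹)).const_mul c
    refine h1.congr_deriv ?_
    field_simp
  pos := h.pos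
  power := h.power.scale hc
  minimal := fun m hm hpow => by
    have h1 := hpow.scale (inv_ne_zero hc)
    rw [scalePeriods_scalePeriods_inv, scaleFun_scaleFun_inv hc] at h1
    exact h.minimal m hm h1

lemma taylorSeries_comp_mul (c : ℂ) (f : ℂ → ℂ) :
    taylorSeries (fun z => f (c * z)) = PowerSeries.rescale c (taylorSeries f) := by
  have h : ∀ n, iteratedDeriv n (fun z => f (c * z)) =
      fun z => c ^ n * iteratedDeriv n f (c * z) := by
    intro n
    induction n with
    | zero => simp
    | succ n ih =>
      rw [iteratedDeriv_succ, ih, iteratedDeriv_succ]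
      funext z
      rw [deriv_const_mul_field, deriv_comp_mul_left c (iteratedDeriv n f) z, smul_eq_mul, pow_succ]
      ring
  ext n
  rw [coeff_taylorSeries, h, PowerSeries.coeff_rescale, coeff_taylorSeries]
  simp only [mul_zero, mul_div_assoc]

lemma taylorSeries_scaleFun (hf : AnalyticAt ℂ f 0) (c : ℂ) :
    taylorSeries (scaleFun c f) = PowerSeries.C c * PowerSeries.rescale c⁻¹ (taylorSeries f) := by
  have h : AnalyticAt ℂ (fun z => f (c⁻¹ * z)) 0 :=
    hf.comp_of_eq (f := fun z => c⁻¹ * z) (by fun_prop) (by simp)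
  rw [← taylorSeries_comp_mul, ← taylorSeries_const c, ← taylorSeries_mul analyticAt_const h]
  rfl

/-- The action of a homothety on parameters: `q_k` has weight `k`. -/
def scaleParameters (t : ℂ) (q : Fin 4 → ℂ) : Fin 4 → ℂ := fun i => t ^ ((i : ℕ) + 1) * q i

lemma IsEllipticOfLevel.hasParameters_scale (hc : c ≠ 0) (h : IsEllipticOfLevel L N f)
    {q : Fin 4 → ℂ} (hq : HasParameters q (taylorSeries f)) :
    HasParameters (scaleParameters c⁻¹ q) (taylorSeries (scaleFun c f)) := by
  obtain ⟨-, -, Q, hQ, hQ0, hQq⟩ := hq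
  obtain ⟨h0, h1⟩ := (h.scale hc).coeff_taylorSeries
  refine ⟨h0, h1, PowerSeries.rescale c⁻¹ Q, ?_, ?_, fun i => ?_⟩
  · rw [taylorSeries_scaleFun h.analyticAt_zero, mul_left_comm, ← map_mul, hQ]
    ext n
    rw [PowerSeries.coeff_C_mul, PowerSeries.coeff_rescale, PowerSeries.coeff_X]
    split_ifs with hn
    · rw [hn]
      field_simp
    · simp
  · rw [PowerSeries.coeff_rescale, pow_zero, one_mul, hQ0]
  · rw [PowerSeries.coeff_rescale, hQq]
    rfl

lemma IsEllipticOfLevel.exists_hasParameters (h : IsEllipticOfLevel L N f) :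
    ∃ q, HasParameters q (taylorSeries f) := by
  obtain ⟨h0, h1⟩ := h.coeff_taylorSeries
  obtain ⟨u, hu⟩ : (PowerSeries.X : PowerSeries ℂ) ∣ taylorSeries f :=
    PowerSeries.X_dvd_iff.2
      (by rw [← PowerSeries.coeff_zero_eq_constantCoeff_apply]; exact h0)
  have hu0 : PowerSeries.constantCoeff u = 1 := by
    rw [hu, show (1 : ℕ) = 0 + 1 from rfl, PowerSeries.coeff_succ_X_mul,
      PowerSeries.coeff_zero_eq_constantCoeff_apply] at h1
    exact h1
  refine ⟨fun i => PowerSeries.coeff ((i : ℕ) + 1) u⁻¹, h0, h1, u⁻¹, ?_, ?_, fun i => rfl⟩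
  · rw [hu, mul_left_comm, PowerSeries.inv_mul_cancel u (by rw [hu0]; exact one_ne_zero), mul_one]
  · rw [PowerSeries.coeff_zero_eq_constantCoeff, PowerSeries.constantCoeff_inv, hu0, inv_one]

lemma IsEllipticOfLevel.mem_levelParameters (h : IsEllipticOfLevel L N f) {q : Fin 4 → ℂ}
    (hq : HasParameters q (taylorSeries f)) : q ∈ levelParameters N :=
  ⟨taylorSeries f, h.isSeriesSolution hq, L, f, h, isExpansionAtZero_taylorSeries h.analyticAt_zero⟩

lemma scaleParameters_mem_levelParameters {t : ℂ} (ht : t ≠ 0) {q : Fin 4 → ℂ}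
    (hq : q ∈ levelParameters N) : scaleParameters t q ∈ levelParameters N := by
  obtain ⟨s, hs, L, f, hf, hsf⟩ := hq
  rw [hsf.eq_taylorSeries] at hs
  have h := hf.hasParameters_scale (inv_ne_zero ht) hs.1
  rw [inv_inv] at h
  exact (hf.scale (inv_ne_zero ht)).mem_levelParameters h

/-- The lattice consists of the zeros of `f`. -/
lemma IsEllipticOfLevel.mem_lattice_iff (h : IsEllipticOfLevel L N f) (z : ℂ) :
    z ∈ L.lattice ↔ 0 < meromorphicOrderAt f z := by
  obtain ⟨ρ, -, -, -, hord⟩ := h.exists_logDeriv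
  have h0 : 0 < meromorphicOrderAt f 0 := by
    have ha := h.analyticAt_zero
    have h1 := ha.analyticOrderAt_sub_eq_one_of_deriv_ne_zero
      (by rw [h.deriv_zero.deriv]; exact one_ne_zero)
    simp only [h.map_zero, sub_zero] at h1
    rw [ha.meromorphicOrderAt_eq, h1]
    exact zero_lt_one
  classical
  constructor
  · intro hz
    have h1 : z - ρ ∈ L.lattice ↔ (0 : ℂ) - ρ ∈ L.lattice := by
      rw [show z - ρ = z + (0 - ρ) by ring]
      exact add_mem_cancel_left hz
    have h2 : levelDivisor L ρ z = levelDivisor L ρ 0 := by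
      simp only [levelDivisor, Set.indicator_apply, Set.mem_ofPred_eq, h1, hz, zero_mem]
    rwa [hord, h2, ← hord]
  · intro hz
    by_contra hn
    rw [hord, levelDivisor] at hz
    have h1 : (0 : ℤ) < Set.indicator {w : ℂ | w ∈ L.lattice} (fun _ => (1 : ℤ)) z
        - Set.indicator {w : ℂ | w - ρ ∈ L.lattice} (fun _ => (1 : ℤ)) z := by exact_mod_cast hz
    simp only [Set.indicator_apply, Set.mem_ofPred_eq, hn, if_false] at h1
    split_ifs at h1 <;> omega

/-- The parameters determine the lattice. -/
theorem mem_lattice_iff_of_hasParameters {L₁ L₂ : PeriodPair} {f₁ f₂ : ℂ → ℂ}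
    (h₁ : IsEllipticOfLevel L₁ N f₁) (h₂ : IsEllipticOfLevel L₂ N f₂) {q : Fin 4 → ℂ}
    (hq₁ : HasParameters q (taylorSeries f₁)) (hq₂ : HasParameters q (taylorSeries f₂)) (z : ℂ) :
    z ∈ L₁.lattice ↔ z ∈ L₂.lattice := by
  have h0 : f₁ =ᶠ[𝓝 0] f₂ := eventuallyEq_of_taylorSeries_eq h₁.analyticAt_zero h₂.analyticAt_zero
    ((h₁.isSeriesSolution hq₁).eq (h₂.isSeriesSolution hq₂))
  have hm₁ : Meromorphic f₁ := fun z => (h₁.meromorphic (Set.mem_univ z)).meromorphicAt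
  have hm₂ : Meromorphic f₂ := fun z => (h₂.meromorphic (Set.mem_univ z)).meromorphicAt
  have hz : meromorphicOrderAt (f₁ - f₂) z = ⊤ := by
    by_contra hz
    refine MeromorphicOn.meromorphicOrderAt_ne_top_of_isPreconnected
      (hm₁.sub hm₂).meromorphicOn isPreconnected_univ (Set.mem_univ z) (Set.mem_univ 0) hz ?_
    rw [meromorphicOrderAt_eq_top_iff]
    filter_upwards [nhdsWithin_le_nhds h0] with w hw
    simp [hw]
  rw [h₁.mem_lattice_iff, h₂.mem_lattice_iff, meromorphicOrderAt_congr]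
  rw [meromorphicOrderAt_eq_top_iff] at hz
  filter_upwards [hz] with w hw
  exact sub_eq_zero.1 hw

end Hirzebruch

/-! ### The locus of level five, and density -/

namespace Hirzebruch

open MvPolynomial (aeval)

/-- The set of common zeros of the two equations of level five. -/
def levelFiveLocus : Set (Fin 4 → ℂ) :=
  {q | (q 0) ^ 4 + 6 * (q 0) ^ 2 * q 1 + 2 * (q 1) ^ 2 + 4 * q 0 * q 2 + q 3 = 0 ∧
    (11 * (q 0) ^ 2 + 3 * q 1) ^ 3 - 4 * (18 * (q 0) ^ 3 + 6 * q 0 * q 1 - q 2) ^ 2 = 0}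

/-- The point of the locus of level five with `q₁ = a`, `11 q₁² + 3 q₂ = 4 s²` and
`18 q₁³ + 6 q₁ q₂ - q₃ = 4 s³`, with coordinates in an arbitrary `ℂ`-algebra. -/
noncomputable def levelFivePoint {A : Type*} [CommRing A] [Algebra ℂ A] (a s : A) : Fin 4 → A :=
  let b := (3⁻¹ : ℂ) • (4 * s ^ 2 - 11 * a ^ 2)
  let c := 18 * a ^ 3 + 6 * a * b - 4 * s ^ 3
  ![a, b, c, -(a ^ 4 + 6 * a ^ 2 * b + 2 * b ^ 2 + 4 * a * c)]

lemma map_levelFivePoint {A B : Type*} [CommRing A] [Algebra ℂ A] [CommRing B] [Algebra ℂ B]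
    (f : A →ₐ[ℂ] B) (a s : A) (i : Fin 4) :
    f (levelFivePoint a s i) = levelFivePoint (f a) (f s) i := by
  fin_cases i <;> simp [levelFivePoint, map_ofNat f]

/-- The curve `x³ = 4 y²` is the image of `s ↦ (4 s², 4 s³)`, which parametrizes the locus. -/
lemma mem_levelFiveLocus_iff {q : Fin 4 → ℂ} :
    q ∈ levelFiveLocus ↔ ∃ a s : ℂ, q = levelFivePoint a s := by
  constructor
  · rintro ⟨h1, h2⟩
    obtain ⟨s, hs2, hs3⟩ : ∃ s : ℂ, 11 * (q 0) ^ 2 + 3 * q 1 = 4 * s ^ 2 ∧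
        18 * (q 0) ^ 3 + 6 * q 0 * q 1 - q 2 = 4 * s ^ 3 := by
      generalize 11 * (q 0) ^ 2 + 3 * q 1 = x at h2
      generalize 18 * (q 0) ^ 3 + 6 * q 0 * q 1 - q 2 = y at h2
      rcases eq_or_ne x 0 with rfl | hx
      · have hy : y = 0 := by simpa using h2
        exact ⟨0, by simp, by simp [hy]⟩
      · refine ⟨y / x, ?_, ?_⟩
        · field_simp
          linear_combination h2
        · field_simp
          linear_combination y * h2
    refine ⟨q 0, s, ?_⟩
    have hb : q 1 = (3⁻¹ : ℂ) * (4 * s ^ 2 - 11 * q 0 ^ 2) := by linear_combination hs2 / 3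
    have hc : q 2 = 18 * q 0 ^ 3 + 6 * q 0 * q 1 - 4 * s ^ 3 := by linear_combination -hs3
    have hd : q 3 = -(q 0 ^ 4 + 6 * q 0 ^ 2 * q 1 + 2 * q 1 ^ 2 + 4 * q 0 * q 2) := by
      linear_combination h1
    ext i
    fin_cases i
    · rfl
    · exact hb
    · simpa [levelFivePoint, ← hb] using hc
    · simpa [levelFivePoint, ← hb, ← hc] using hd
  · rintro ⟨a, s, rfl⟩
    simp only [levelFiveLocus, levelFivePoint, Set.mem_ofPred_eq, smul_eq_mul]
    constructor
    · simp
    · simp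
      ring

/-- The pullback of polynomial functions along the parametrization of the locus. -/
noncomputable def levelFivePullback : MvPolynomial (Fin 4) ℂ →ₐ[ℂ] MvPolynomial (Fin 2) ℂ :=
  aeval (levelFivePoint (MvPolynomial.X 0) (MvPolynomial.X 1))

lemma aeval_levelFivePullback (x : Fin 2 → ℂ) (F : MvPolynomial (Fin 4) ℂ) :
    aeval x (levelFivePullback F) = aeval (levelFivePoint (x 0) (x 1)) F := by
  have h : (aeval x).comp levelFivePullback = aeval (levelFivePoint (x 0) (x 1)) := by
    refine MvPolynomial.algHom_ext fun i => ?_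
    rw [AlgHom.comp_apply, levelFivePullback, MvPolynomial.aeval_X, map_levelFivePoint,
      MvPolynomial.aeval_X, MvPolynomial.aeval_X, MvPolynomial.aeval_X]
  exact DFunLike.congr_fun h F

lemma mem_vanishingIdeal_levelFiveLocus {F : MvPolynomial (Fin 4) ℂ} :
    F ∈ MvPolynomial.vanishingIdeal ℂ levelFiveLocus ↔ levelFivePullback F = 0 := by
  rw [MvPolynomial.mem_vanishingIdeal_iff]
  constructor
  · intro h
    refine MvPolynomial.funext fun x => ?_
    rw [← MvPolynomial.coe_aeval_eq_eval, RingHom.coe_coe, aeval_levelFivePullback, map_zero]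
    exact h _ (mem_levelFiveLocus_iff.2 ⟨_, _, rfl⟩)
  · rintro h q hq
    obtain ⟨a, s, rfl⟩ := mem_levelFiveLocus_iff.1 hq
    simpa [h] using (aeval_levelFivePullback ![a, s] F).symm

lemma zeroLocus_vanishingIdeal_levelFiveLocus :
    MvPolynomial.zeroLocus ℂ (MvPolynomial.vanishingIdeal ℂ levelFiveLocus) = levelFiveLocus := by
  refine Set.Subset.antisymm (fun q hq => ?_) (MvPolynomial.zeroLocus_vanishingIdeal_le _)
  rw [MvPolynomial.mem_zeroLocus_iff] at hq
  open MvPolynomial in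
  constructor
  · have h := hq (X 0 ^ 4 + 6 * X 0 ^ 2 * X 1 + 2 * X 1 ^ 2 + 4 * X 0 * X 2 + X 3)
      fun p hp => by simpa using hp.1
    simpa using h
  · have h := hq ((11 * X 0 ^ 2 + 3 * X 1) ^ 3 - 4 * (18 * X 0 ^ 3 + 6 * X 0 * X 1 - X 2) ^ 2)
      fun p hp => by simpa using hp.2
    simpa using h

lemma levelParameters_five_subset : levelParameters 5 ⊆ levelFiveLocus := by
  rintro q ⟨s, hs, L, f, hf, hsf⟩
  rw [hsf.eq_taylorSeries] at hs
  exact hf.levelFive_equations hs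

lemma levelFivePoint_mul (t a s : ℂ) :
    levelFivePoint (t * a) (t * s) = scaleParameters t (levelFivePoint a s) := by
  ext i
  fin_cases i <;> simp [levelFivePoint, scaleParameters] <;> ring

/-- Only countably many lattices `⟨1, τ'⟩` are homothetic to `⟨1, τ⟩`. -/
lemma countable_setOf_homothetic {τ : ℂ} (hτ : 0 < τ.im) :
    {τ' : {τ : ℂ // 0 < τ.im} | ∃ t : ℂ, t ≠ 0 ∧ ∀ z : ℂ,
      z ∈ (tauPeriods τ' τ'.2).lattice ↔ t * z ∈ (tauPeriods τ hτ).lattice}.Countable := by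
  have h : (Subtype.val '' {τ' : {τ : ℂ // 0 < τ.im} | ∃ t : ℂ, t ≠ 0 ∧ ∀ z : ℂ,
      z ∈ (tauPeriods τ' τ'.2).lattice ↔ t * z ∈ (tauPeriods τ hτ).lattice}).Countable := by
    refine (Set.countable_range fun k : (ℤ × ℤ) × (ℤ × ℤ) =>
      ((k.1.1 + k.1.2 * τ) / (k.2.1 + k.2.2 * τ) : ℂ)).mono ?_
    rintro _ ⟨τ', ⟨t, ht, h⟩, rfl⟩
    obtain ⟨m, n, h1⟩ := (mem_tauPeriods hτ).1 ((h 1).1 ((mem_tauPeriods τ'.2).2 ⟨1, 0, by simp⟩))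
    obtain ⟨k, l, h2⟩ := (mem_tauPeriods hτ).1 ((h τ').1 ((mem_tauPeriods τ'.2).2 ⟨0, 1, by simp⟩))
    refine ⟨((k, l), (m, n)), ?_⟩
    simp only [h1, h2, mul_one]
    exact mul_div_cancel_left₀ _ ht
  exact Set.countable_of_injective_of_countable_image Subtype.val_injective.injOn h

lemma not_countable_upperHalfPlane : ¬ Countable {τ : ℂ // 0 < τ.im} := by
  intro h
  have h1 : (Set.ofPred fun τ : ℂ => 0 < τ.im).Countable := Set.countable_coe_iff.1 h
  have h2 := h1.dense_compl ℝ
  obtain ⟨z, hz, hz'⟩ := h2.inter_open_nonempty _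
    (isOpen_lt continuous_const Complex.continuous_im) ⟨Complex.I, by simpa using one_pos⟩
  exact hz' hz

/-- The ratios `a / s` of the parametrized points of `levelParameters 5` are infinitely many: the
parameters determine the lattice, and up to homothety there are uncountably many lattices. -/
lemma infinite_ratios :
    {r : ℂ | ∃ a s : ℂ, s ≠ 0 ∧ levelFivePoint a s ∈ levelParameters 5 ∧ r = a / s}.Infinite := by
  have hex : ∀ τ : {τ : ℂ // 0 < τ.im}, ∃ a s : ℂ,
      HasParameters (levelFivePoint a s) (taylorSeries (levelFiveFunction τ)) := by
    intro τ
    have hf := isEllipticOfLevel_levelFiveFunction τ.2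
    obtain ⟨q, hq⟩ := hf.exists_hasParameters
    obtain ⟨a, s, rfl⟩ :=
      mem_levelFiveLocus_iff.1 (levelParameters_five_subset (hf.mem_levelParameters hq))
    exact ⟨a, s, hq⟩
  choose a s has using hex
  set R := {r : ℂ | ∃ a s : ℂ, s ≠ 0 ∧ levelFivePoint a s ∈ levelParameters 5 ∧ r = a / s}
  intro hR
  -- The point `(a τ : s τ)` of the projective line, normalized; `(0, 0)` if it is undefined.
  let κ : {τ : ℂ // 0 < τ.im} → ℂ × ℂ := fun τ =>
    if s τ ≠ 0 then (a τ / s τ, 1) else if a τ ≠ 0 then (1, 0) else (0, 0)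
  have hκ : ∀ τ τ', κ τ' = κ τ → ∃ t : ℂ, t ≠ 0 ∧ a τ' = t * a τ ∧ s τ' = t * s τ := by
    intro τ τ' h
    by_cases h1 : s τ = 0 <;> by_cases h2 : s τ' = 0 <;>
      simp only [κ, h1, h2, ne_eq, not_true_eq_false, not_false_eq_true, if_true, if_false] at h
    · by_cases h3 : a τ = 0 <;> by_cases h4 : a τ' = 0 <;> simp [h3, h4] at h
      · exact ⟨1, one_ne_zero, by simp [h3, h4], by simp [h1, h2]⟩
      · exact ⟨a τ' / a τ, div_ne_zero h4 h3, by field_simp, by simp [h1, h2]⟩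
    · split_ifs at h <;> simp at h
    · split_ifs at h <;> simp at h
    · refine ⟨s τ' / s τ, div_ne_zero h2 h1, ?_, by field_simp⟩
      have h3 := (Prod.ext_iff.1 h).1
      rw [div_eq_div_iff h2 h1] at h3
      field_simp
      linear_combination h3
  have hrange : (Set.range κ).Countable := by
    refine ((hR.image fun r => (r, (1 : ℂ))).countable.union
      ((Set.countable_singleton ((1 : ℂ), (0 : ℂ))).union
        (Set.countable_singleton ((0 : ℂ), (0 : ℂ))))).mono ?_
    rintro _ ⟨τ, rfl⟩
    by_cases h1 : s τ = 0
    · right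
      by_cases h2 : a τ = 0 <;> simp [κ, h1, h2]
    · left
      refine ⟨a τ / s τ, ⟨a τ, s τ, h1, ?_, rfl⟩, by simp [κ, h1]⟩
      exact (isEllipticOfLevel_levelFiveFunction τ.2).mem_levelParameters (has τ)
  have hfibre : ∀ k ∈ Set.range κ, (κ ⁻¹' {k}).Countable := by
    rintro _ ⟨τ, rfl⟩
    refine (countable_setOf_homothetic τ.2).mono fun τ' hτ' => ?_
    obtain ⟨t, ht, h1, h2⟩ := hκ τ τ' hτ'
    refine ⟨t, ht, fun z => ?_⟩
    have hf := isEllipticOfLevel_levelFiveFunction τ.2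
    have hf' := isEllipticOfLevel_levelFiveFunction τ'.2
    have hq := hf.hasParameters_scale (inv_ne_zero ht) (has τ)
    rw [inv_inv, ← levelFivePoint_mul, ← h1, ← h2] at hq
    rw [mem_lattice_iff_of_hasParameters hf' (hf.scale (inv_ne_zero ht)) (has τ') hq,
      mem_scalePeriods, inv_inv]
  refine not_countable_upperHalfPlane (Set.countable_univ_iff.1 ?_)
  refine (hrange.biUnion hfibre).mono fun τ _ => ?_
  exact Set.mem_biUnion (Set.mem_range_self τ) rfl

/-- A polynomial that vanishes on `levelParameters 5` pulls back to a polynomial in `a` and `s`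
which vanishes, by homogeneity, on infinitely many lines through the origin. -/
lemma levelFivePullback_eq_zero {F : MvPolynomial (Fin 4) ℂ}
    (hF : F ∈ MvPolynomial.vanishingIdeal ℂ (levelParameters 5)) : levelFivePullback F = 0 := by
  set G := levelFivePullback F
  let H : MvPolynomial (Fin 2) ℂ :=
    aeval ![MvPolynomial.X 0 * MvPolynomial.X 1, MvPolynomial.X 1] G
  have hHG : ∀ x : Fin 2 → ℂ, aeval x H = aeval ![x 0 * x 1, x 1] G := by
    intro x
    have h : (aeval x).comp (aeval ![MvPolynomial.X 0 * MvPolynomial.X 1, MvPolynomial.X 1]) =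
        (aeval ![x 0 * x 1, x 1] : MvPolynomial (Fin 2) ℂ →ₐ[ℂ] ℂ) := by
      refine MvPolynomial.algHom_ext fun i => ?_
      fin_cases i <;> simp
    exact DFunLike.congr_fun h G
  have hinf : ({0}ᶜ : Set ℂ).Infinite := (Set.finite_singleton 0).infinite_compl
  have hH : H = 0 := by
    refine MvPolynomial.funext_set
      ![{r : ℂ | ∃ a s : ℂ, s ≠ 0 ∧ levelFivePoint a s ∈ levelParameters 5 ∧ r = a / s}, {0}ᶜ]
      (fun i => by fin_cases i <;> [exact infinite_ratios; exact hinf]) fun x hx => ?_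
    obtain ⟨a, s, hs, hq, hr⟩ := hx 0 (Set.mem_univ _)
    have hx1 : x 1 ≠ 0 := hx 1 (Set.mem_univ _)
    rw [← MvPolynomial.coe_aeval_eq_eval, RingHom.coe_coe, hHG, aeval_levelFivePullback, map_zero]
    have h := hF _ (scaleParameters_mem_levelParameters (div_ne_zero hx1 hs) hq)
    rw [← levelFivePoint_mul] at h
    have h0 : x 0 * x 1 = x 1 / s * a := by
      rw [hr]
      ring
    have h1 : x 1 = x 1 / s * s := (div_mul_cancel₀ _ hs).symm
    rw [← h0, ← h1] at h
    exact h
  refine MvPolynomial.funext_set ![Set.univ, {0}ᶜ]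
    (fun i => by fin_cases i <;> [exact Set.infinite_univ; exact hinf]) fun x hx => ?_
  have hx1 : x 1 ≠ 0 := hx 1 (Set.mem_univ _)
  have h := hHG ![x 0 / x 1, x 1]
  rw [hH, map_zero] at h
  rw [← MvPolynomial.coe_aeval_eq_eval, RingHom.coe_coe, map_zero, h]
  congr 1
  congr 1
  ext i
  fin_cases i <;> simp [hx1]

theorem levelVariety_five : levelVariety 5 = levelFiveLocus := by
  rw [← zeroLocus_vanishingIdeal_levelFiveLocus]
  refine Set.Subset.antisymm ?_ ?_
  · exact MvPolynomial.zeroLocus_anti_mono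
      (MvPolynomial.vanishingIdeal_anti_mono levelParameters_five_subset)
  · exact MvPolynomial.zeroLocus_anti_mono fun F hF =>
      mem_vanishingIdeal_levelFiveLocus.2 (levelFivePullback_eq_zero hF)

/-! ### Irreducibility and dimension -/

theorem isZariskiIrreducible_levelFiveLocus : IsZariskiIrreducible levelFiveLocus := by
  refine ⟨⟨_, mem_levelFiveLocus_iff.2 ⟨0, 0, rfl⟩⟩, ?_⟩
  rintro _ _ ⟨I₁, rfl⟩ ⟨I₂, rfl⟩ h
  by_contra! hn
  simp only [MvPolynomial.le_zeroLocus_iff_le_vanishingIdeal, SetLike.not_le_iff_exists] at hn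
  obtain ⟨⟨F₁, hF₁, h₁⟩, F₂, hF₂, h₂⟩ := hn
  rw [mem_vanishingIdeal_levelFiveLocus] at h₁ h₂
  refine mul_ne_zero h₁ h₂ ?_
  rw [← map_mul, ← mem_vanishingIdeal_levelFiveLocus]
  intro q hq
  rw [map_mul]
  rcases h hq with h | h
  · rw [h F₁ hF₁, zero_mul]
  · rw [h F₂ hF₂, mul_zero]

/-- Integral ring homomorphisms do not lower the dimension: the fibres of the induced map of
spectra have no inclusions. -/
lemma ringKrullDim_le_of_isIntegral {A B : Type*} [CommRing A] [CommRing B] (f : A →+* B)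
    (hf : f.IsIntegral) : ringKrullDim B ≤ ringKrullDim A := by
  let _ : Algebra A B := f.toAlgebra
  have : Algebra.IsIntegral A B := ⟨hf⟩
  refine Order.krullDim_le_of_strictMono (PrimeSpectrum.comap f) fun P Q hPQ => ?_
  exact Ideal.IsIntegral.comap_lt_comap (R := A) (A := B) hPQ

/-- A ring homomorphism into a quotient of a polynomial ring over `ℂ` is integral if the constants
and the classes of the variables are integral elements. -/
lemma isIntegral_of_isIntegralElem_X {σ A B : Type*} [CommRing A] [CommRing B] (f : A →+* B)
    (g : MvPolynomial σ ℂ →+* B) (hg : Function.Surjective g)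
    (hC : ∀ c, f.IsIntegralElem (g (MvPolynomial.C c)))
    (hX : ∀ i, f.IsIntegralElem (g (MvPolynomial.X i))) : f.IsIntegral := by
  intro b
  obtain ⟨p, rfl⟩ := hg b
  induction p using MvPolynomial.induction_on with
  | C c => exact hC c
  | add p q hp hq => rw [map_add]; exact hp.add f hq
  | mul_X p i hp => rw [map_mul]; exact hp.mul f (hX i)

lemma ringKrullDim_mvPolynomial_two : ringKrullDim (MvPolynomial (Fin 2) ℂ) = 2 := by
  rw [MvPolynomial.ringKrullDim_of_isNoetherianRing, ringKrullDim_eq_zero_of_field]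
  simp

lemma isIntegralElem_of_sq {A B : Type*} [CommRing A] [CommRing B] (f : A →+* B) {a : A} {b : B}
    (h : b ^ 2 = f a) : f.IsIntegralElem b :=
  ⟨Polynomial.X ^ 2 - Polynomial.C a, Polynomial.monic_X_pow_sub_C a two_ne_zero, by simp [h]⟩

/-- The ring of polynomials in `a` and `s` is integral over the coordinate ring of the locus. -/
lemma two_le_algebraicDim_levelFiveLocus : 2 ≤ algebraicDim levelFiveLocus := by
  rw [← ringKrullDim_mvPolynomial_two]
  let f : MvPolynomial (Fin 4) ℂ ⧸ MvPolynomial.vanishingIdeal ℂ levelFiveLocus →+*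
      MvPolynomial (Fin 2) ℂ := Ideal.Quotient.lift _ levelFivePullback.toRingHom
    fun F hF => mem_vanishingIdeal_levelFiveLocus.1 hF
  have hf : ∀ F, f (Ideal.Quotient.mk _ F) = levelFivePullback F := fun F => rfl
  refine ringKrullDim_le_of_isIntegral f (isIntegral_of_isIntegralElem_X f (RingHom.id _)
    Function.surjective_id (fun c => ?_) (Fin.forall_fin_two.2 ⟨?_, ?_⟩))
  · rw [RingHom.id_apply, show MvPolynomial.C c = f (Ideal.Quotient.mk _ (MvPolynomial.C c)) from
      (levelFivePullback.commutes c).symm]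
    exact f.isIntegralElem_map
  · rw [RingHom.id_apply, show MvPolynomial.X 0 = f (Ideal.Quotient.mk _ (MvPolynomial.X 0)) by
      rw [hf, levelFivePullback, MvPolynomial.aeval_X]; rfl]
    exact f.isIntegralElem_map
  · refine isIntegralElem_of_sq f (a := Ideal.Quotient.mk _ ((4⁻¹ : ℂ) •
      (11 * MvPolynomial.X 0 ^ 2 + 3 * MvPolynomial.X 1))) ?_
    rw [hf, map_smul, eq_inv_smul_iff₀ (by norm_num)]
    have h : levelFivePullback (MvPolynomial.X 1) =
        (3⁻¹ : ℂ) • (4 * MvPolynomial.X 1 ^ 2 - 11 * MvPolynomial.X 0 ^ 2) :=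
      MvPolynomial.aeval_X _ 1
    have h' : levelFivePullback (MvPolynomial.X 0) = MvPolynomial.X 0 := MvPolynomial.aeval_X _ 0
    rw [eq_inv_smul_iff₀ (by norm_num), ofNat_smul_eq_nsmul, nsmul_eq_mul] at h
    rw [ofNat_smul_eq_nsmul, nsmul_eq_mul]
    simp only [map_add, map_mul, map_pow, map_ofNat, h']
    push_cast at h ⊢
    simp only [id_eq]
    linear_combination -h

/-- The coordinate ring of the locus is integral over the ring of polynomials in `q₁` and
`11 q₁² + 3 q₂`. -/
lemma algebraicDim_levelFiveLocus_le : algebraicDim levelFiveLocus ≤ 2 := by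
  rw [← ringKrullDim_mvPolynomial_two]
  set I := MvPolynomial.vanishingIdeal ℂ levelFiveLocus
  let x : Fin 4 → MvPolynomial (Fin 4) ℂ ⧸ I := fun i => Ideal.Quotient.mk I (MvPolynomial.X i)
  let f : MvPolynomial (Fin 2) ℂ →ₐ[ℂ] MvPolynomial (Fin 4) ℂ ⧸ I :=
    aeval ![x 0, 11 * x 0 ^ 2 + 3 * x 1]
  have h1 : x 0 ^ 4 + 6 * x 0 ^ 2 * x 1 + 2 * x 1 ^ 2 + 4 * x 0 * x 2 + x 3 = 0 := by
    open MvPolynomial in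
    refine (Ideal.Quotient.eq_zero_iff_mem (a := X 0 ^ 4 + 6 * X 0 ^ 2 * X 1 + 2 * X 1 ^ 2
      + 4 * X 0 * X 2 + X 3)).2 fun q hq => ?_
    simpa using hq.1
  have h2 : (11 * x 0 ^ 2 + 3 * x 1) ^ 3 - 4 * (18 * x 0 ^ 3 + 6 * x 0 * x 1 - x 2) ^ 2 = 0 := by
    open MvPolynomial in
    refine (Ideal.Quotient.eq_zero_iff_mem (a := (11 * X 0 ^ 2 + 3 * X 1) ^ 3
      - 4 * (18 * X 0 ^ 3 + 6 * X 0 * X 1 - X 2) ^ 2)).2 fun q hq => ?_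
    simpa using hq.2
  have e0 : f (MvPolynomial.X 0) = x 0 := by simp [f]
  have e1 : f (MvPolynomial.X 1) = 11 * x 0 ^ 2 + 3 * x 1 := by simp [f]
  -- Integral elements form a subalgebra, in which the generators are found one after another.
  let _ : Algebra (MvPolynomial (Fin 2) ℂ) (MvPolynomial (Fin 4) ℂ ⧸ I) := f.toRingHom.toAlgebra
  let S := integralClosure (MvPolynomial (Fin 2) ℂ) (MvPolynomial (Fin 4) ℂ ⧸ I)
  have hS : ∀ p, f p ∈ S := fun p => S.algebraMap_mem p
  have hCS : ∀ (c : ℂ) {y}, y ∈ S → c • y ∈ S := fun c y hy => by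
    have h := S.mul_mem (hS (MvPolynomial.C c)) hy
    rwa [show f (MvPolynomial.C c) = algebraMap ℂ _ c from f.commutes c, ← Algebra.smul_def] at h
  have hx0 : x 0 ∈ S := e0 ▸ hS _
  have ht : 11 * x 0 ^ 2 + 3 * x 1 ∈ S := e1 ▸ hS _
  have hn : ∀ n : ℕ, (n : MvPolynomial (Fin 4) ℂ ⧸ I) ∈ S := fun n => natCast_mem S n
  have hx1 : x 1 ∈ S := by
    have h := hCS 3⁻¹ (S.sub_mem ht (S.mul_mem (hn 11) (S.pow_mem hx0 2)))
    rwa [show 11 * x 0 ^ 2 + 3 * x 1 - (11 : ℕ) * x 0 ^ 2 = (3 : ℂ) • x 1 by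
      rw [ofNat_smul_eq_nsmul, nsmul_eq_mul]; push_cast; ring, inv_smul_smul₀ (by norm_num)] at h
  have hp : 18 * x 0 ^ 3 + 6 * x 0 * x 1 ∈ S := S.add_mem
    (S.mul_mem (hn 18) (S.pow_mem hx0 3)) (S.mul_mem (S.mul_mem (hn 6) hx0) hx1)
  have hy : 18 * x 0 ^ 3 + 6 * x 0 * x 1 - x 2 ∈ S := by
    refine IsIntegral.of_pow two_pos ?_
    have h := hCS 4⁻¹ (S.pow_mem ht 3)
    rwa [show (11 * x 0 ^ 2 + 3 * x 1) ^ 3 =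
      (4 : ℂ) • (18 * x 0 ^ 3 + 6 * x 0 * x 1 - x 2) ^ 2 by
        rw [ofNat_smul_eq_nsmul, nsmul_eq_mul]; push_cast; linear_combination h2,
      inv_smul_smul₀ (by norm_num)] at h
  have hx2 : x 2 ∈ S := by
    have h := S.sub_mem hp hy
    rwa [sub_sub_cancel] at h
  have hx3 : x 3 ∈ S := by
    rw [eq_neg_of_add_eq_zero_right h1]
    exact S.neg_mem (S.add_mem (S.add_mem (S.add_mem (S.pow_mem hx0 4)
      (S.mul_mem (S.mul_mem (hn 6) (S.pow_mem hx0 2)) hx1)) (S.mul_mem (hn 2) (S.pow_mem hx1 2)))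
      (S.mul_mem (S.mul_mem (hn 4) hx0) hx2))
  refine ringKrullDim_le_of_isIntegral f.toRingHom (isIntegral_of_isIntegralElem_X _
    (Ideal.Quotient.mk I) Ideal.Quotient.mk_surjective (fun c => ?_) fun i => ?_)
  · have h := hS (MvPolynomial.C c)
    rwa [show f (MvPolynomial.C c) = Ideal.Quotient.mk I (MvPolynomial.C c) from f.commutes c] at h
  · fin_cases i
    exacts [hx0, hx1, hx2, hx3]

end Hirzebruch

theorem mainTheorem4 :
    Hirzebruch.levelVariety 5 =
      {q : Fin 4 → ℂ |
        (q 0) ^ 4 + 6 * (q 0) ^ 2 * q 1 + 2 * (q 1) ^ 2 + 4 * q 0 * q 2 + q 3 = 0 ∧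
        (11 * (q 0) ^ 2 + 3 * q 1) ^ 3
          - 4 * (18 * (q 0) ^ 3 + 6 * q 0 * q 1 - q 2) ^ 2 = 0} ∧
    Hirzebruch.IsZariskiIrreducible (Hirzebruch.levelVariety 5) ∧
    Hirzebruch.algebraicDim (Hirzebruch.levelVariety 5) = 2 ∧
    ∀ f : PowerSeries ℂ, Hirzebruch.CorrespondsToLevel 5 f ↔
      ∃ q : Fin 4 → ℂ, Hirzebruch.IsSeriesSolution q f ∧
        (q 0) ^ 4 + 6 * (q 0) ^ 2 * q 1 + 2 * (q 1) ^ 2 + 4 * q 0 * q 2 + q 3 = 0 ∧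
        (11 * (q 0) ^ 2 + 3 * q 1) ^ 3
          - 4 * (18 * (q 0) ^ 3 + 6 * q 0 * q 1 - q 2) ^ 2 = 0 := by
  rw [Hirzebruch.levelVariety_five]
  refine ⟨rfl, Hirzebruch.isZariskiIrreducible_levelFiveLocus,
    le_antisymm Hirzebruch.algebraicDim_levelFiveLocus_le
      Hirzebruch.two_le_algebraicDim_levelFiveLocus, fun f => ?_⟩
  rw [Hirzebruch.CorrespondsToLevel, Hirzebruch.levelVariety_five]
  exact exists_congr fun q => and_comm
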